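/- Let $n\ge 1$. Let $CRY_n$ (the Chan–Robbins–Yuen polytope) be the set of real $n\times n$ matrices $(x_{ij})$ with nonnegative entries, all row and column sums equal to $1$, and $x_{ij}=0$ whenever $j\ge i+2$. Its volume is measured in its affine span, with the Lebesgue measure for which the lattice of integral $n\times n$ matrices lying in the linear space parallel to this affine span has covolume $1$; its relative volume is $(\dim CRY_n)!$ times this volume. Then the relative volume of $CRY_n$ equals $$\prod_{i=1}^{n-2}\frac{1}{i+1}\binom{2i}{i},$$ the product of the first $n-2$ Catalan numbers (an empty product being $1$). Equivalently, let $e^1,\dots,e^{n+1}$ be the standard basis of $\mathbb R^{n+1}$, let $A_n^+=\{e^i-e^j: 1\le i<j\le n+1\}$, let $N=\binom{n+1}{2}$, and let $$P_{A_n^+}(e^1-e^{n+1})=\Big\{(u_{ij})_{i<j}\in\mathbb R_{\ge0}^{N}:\ \sum_{i<j}u_{ij}(e^i-e^j)=e^1-e^{n+1}\Big\}.$$ Let $E_n\subset\mathbb R^{n+1}$ be the $n$-dimensional span of $A_n^+$, with the Lebesgue measure $da$ for which the lattice generated by $A_n^+$ has covolume $1$. Measure the volume of $P_{A_n^+}(e^1-e^{n+1})$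 with the translation-invariant measure on the fibres of $u\mapsto\sum_{i<j} u_{ij}(e^i-e^j)$, $\mathbb R^N\to E_n$, that is the quotient of the standard Lebesgue measure of $\mathbb R^N$ by $da$. Then the relative volume $(N-n)!\,\operatorname{vol}P_{A_n^+}(e^1-e^{n+1})$ equals the same product. -/

import Mathlib

open MeasureTheory

noncomputable section

/-- The trace on a real subspace `W ⊆ E` of an additive subgroup `L` of `E`. -/
def latticeIn {E : Type*} [AddCommGroup E] [Module ℝ E]
    (W : Submodule ℝ E) (L : Submodule ℤ E) : Submodule ℤ W :=
  L.comap (W.subtype.restrictScalars ℤ)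

/-- The Lebesgue (Haar) measure on `E` for which the lattice `L` has covolume `1`. -/
def latticeMeasure {E : Type*} [NormedAddCommGroup E] [NormedSpace ℝ E] [FiniteDimensional ℝ E]
    [MeasurableSpace E] [BorelSpace E] (L : Submodule ℤ E) : Measure E :=
  (ENNReal.ofReal (ZLattice.covolume L Measure.addHaar))⁻¹ • Measure.addHaar

/-- The lattice `ℤ^ι` of integral vectors in `ℝ^ι`. -/
def integralVectors (ι : Type*) : Submodule ℤ (ι → ℝ) where
  carrier := {x | ∀ i, ∃ m : ℤ, x i = m}
  add_mem' := fun {x y} hx hy i => by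
    obtain ⟨a, ha⟩ := hx i
    obtain ⟨b, hb⟩ := hy i
    exact ⟨a + b, by simp [ha, hb]⟩
  zero_mem' := fun _ => ⟨0, by simp⟩
  smul_mem' := fun c x hx i => by
    obtain ⟨a, ha⟩ := hx i
    exact ⟨c * a, by simp [ha]⟩

/-- For `P` contained in a translate of the subspace `W`, the set of all `w ∈ W` with
`u₀ + w ∈ P`, where `u₀` is some point of `P` (its measure for a translation invariant measure
on `W` does not depend on `u₀`). It is empty when `P` is empty. -/
def translateTo {E : Type*} [AddCommGroup E] [Module ℝ E]
    (W : Submodule ℝ E) (P : Set E) : Set W :=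
  {w | ∃ h : P.Nonempty, h.some + (w : E) ∈ P}

/-- The volume of a polytope `P ⊆ ℝ^ι` inside its affine span, the unit of volume being given by
the integral vectors parallel to that affine span. -/
def latticeVolume {ι : Type*} [Fintype ι] (P : Set (ι → ℝ)) : ℝ :=
  (latticeMeasure (latticeIn (affineSpan ℝ P).direction (integralVectors ι))).real
    (translateTo (affineSpan ℝ P).direction P)

/-- The relative volume: the lattice volume divided by that of the standard simplex, i.e.
multiplied by `(dim P)!`. -/
def latticeRelVolume {ι : Type*} [Fintype ι] (P : Set (ι → ℝ)) : ℝ :=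
  ((Module.finrank ℝ (affineSpan ℝ P).direction).factorial : ℝ) * latticeVolume P

/-- The Chan–Robbins–Yuen polytope: doubly stochastic `n × n` matrices with `x i j = 0` whenever
`j ≥ i + 2`, as a subset of `ℝ^(n × n)`. -/
def CRY (n : ℕ) : Set (Fin n × Fin n → ℝ) :=
  {X | Matrix.of (Function.curry X) ∈ doublyStochastic ℝ (Fin n) ∧
    ∀ i j : Fin n, (i : ℕ) + 2 ≤ (j : ℕ) → X (i, j) = 0}

section Partition

variable {ι E : Type*} [Fintype ι] [NormedAddCommGroup E] [NormedSpace ℝ E]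
  [FiniteDimensional ℝ E] [MeasurableSpace E] [BorelSpace E]

/-- The polytope `P_Φ(a)` of nonnegative solutions `u` of `∑ k, u k • Φ k = a`. -/
def partitionPolytope (Φ : ι → E) (a : E) : Set (ι → ℝ) :=
  {u | (∀ k, 0 ≤ u k) ∧ ∑ k, u k • Φ k = a}

/-- The linear map `u ↦ ∑ k, u k • Φ k`. -/
def partitionMap (Φ : ι → E) : (ι → ℝ) →ₗ[ℝ] E := Fintype.linearCombination ℝ Φ

/-- The measure `da` on the real span of `Φ` normalized by the lattice generated by `Φ`. -/
def spanMeasure (Φ : ι → E) : Measure (LinearMap.range (partitionMap Φ)) :=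
  latticeMeasure (latticeIn (LinearMap.range (partitionMap Φ)) (Submodule.span ℤ (Set.range Φ)))

/-- `dm` is the Lebesgue measure on the kernel of `u ↦ ∑ k, u k • Φ k` that is the quotient of the
standard Lebesgue measure of `ℝ^ι` by `da`: for every linear section `s` the isomorphism
`(m, a) ↦ m + s a` carries `dm × da` to the standard Lebesgue measure. -/
def IsQuotientMeasure (Φ : ι → E) (dm : Measure (LinearMap.ker (partitionMap Φ))) : Prop :=
  dm.IsAddHaarMeasure ∧
    ∀ s : LinearMap.range (partitionMap Φ) →ₗ[ℝ] (ι → ℝ),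
      (∀ a, partitionMap Φ (s a) = (a : E)) →
      MeasurePreserving
        (fun x : LinearMap.ker (partitionMap Φ) × LinearMap.range (partitionMap Φ) =>
          (x.1 : ι → ℝ) + s x.2)
        (dm.prod (spanMeasure Φ)) volume

open Classical in
/-- The quotient measure `dm` on the kernel. -/
def quotientMeasure (Φ : ι → E) : Measure (LinearMap.ker (partitionMap Φ)) :=
  if h : ∃ dm, IsQuotientMeasure Φ dm then h.choose else 0

/-- The volume of `P_Φ(a)` for the measure `dm`, transported to the fibre over `a`. -/
def partitionVolume (Φ : ι → E) (a : E) : ℝ :=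
  (quotientMeasure Φ).real (translateTo (LinearMap.ker (partitionMap Φ)) (partitionPolytope Φ a))

/-- The relative volume `(N - r)! vol P_Φ(a)`, where `N - r` is the dimension of the kernel. -/
def partitionRelVolume (Φ : ι → E) (a : E) : ℝ :=
  ((Module.finrank ℝ (LinearMap.ker (partitionMap Φ))).factorial : ℝ) * partitionVolume Φ a

end Partition

/-- The positive root system `A_n^+`: the vectors `e^i - e^j` of `ℝ^(n+1)`, `i < j`. -/
def posRoots (n : ℕ) (q : {q : Fin (n + 1) × Fin (n + 1) // q.1 < q.2}) : Fin (n + 1) → ℝ :=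
  Pi.single q.1.1 1 - Pi.single q.1.2 1

end

/-! The Chan–Robbins–Yuen polytope is an integral copy of the polytope of unit flows on the complete
graph with vertices `0, …, n`. The entry `(i, j)` with `j ≤ i` is the flow from `j` to `i + 1`, and
the superdiagonal holds the slack `1 - inflow`. Both relative volumes therefore reduce to the
Lebesgue volume of one set, `flowSet (Pi.single 0 1)`. This set consists of the flows on the first
`n` vertices, where the conservation equations determine what enters the sink and nonnegativity of
that quantity becomes an inequality. The comparison of measures is `latticeRelVolume_image` for the
first volume and `quotientMeasure_posRoots` for the second.

The volume is computed analytically. Integrating out the flows leaving vertex `0` and then the later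
vertices, with the Hermite–Genocchi formula at each stage, gives (`volume_flowSet`) the volume for
supplies `x` as the constant term of `exp(∑ xᵢ yᵢ) ∏_{i<j} (yᵢ - yⱼ)⁻¹` on a torus with decreasing
radii. For supply `s` at vertex `0` only, the volume is `s^d` times the one wanted, where `d` is the
number of edges. Integrating against `exp(-s)` thus produces `d!` times the volume on one side and
`(1 - y₀)⁻¹` in the constant term on the other. A residue in `y₀` leaves the constant term `F_m` of
`flowDensity` in `m = n - 1` variables.

Evaluating `F_r` in its smallest variable replaces `flowDensity` by `morrisDensity`, in one variable
fewer. The latter is a case of the Morris constant term, and Aomoto's method gives its ratio to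
`F_{r-1}`: exact derivatives integrate to zero, and antisymmetrizing such a relation yields a
recursion between the terms weighted by `x₁ ⋯ x_k` for consecutive `k`. The ratio is the Catalan
number `C_{r-1}`, so `F_m = C_0 ⋯ C_{m-1}`. -/

noncomputable section

/-! ### Constant terms as averages over tori. -/

/-- The point `ρ e^{2πiθ}` of the circle of radius `ρ`. -/
def circlePoint (ρ : ℝ) (θ : UnitAddCircle) : ℂ := ρ * (AddCircle.toCircle θ : ℂ)

/-- The point of the torus with radii `R` and angles `θ`. -/
def torusPoint {r : ℕ} (R : Fin r → ℝ) (θ : Fin r → UnitAddCircle) : Fin r → ℂ :=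
  fun i => circlePoint (R i) (θ i)

/-- The average of `f` over the torus with radii `R`: the constant term of the Laurent expansion
of `f` near that torus. -/
def constantTerm {r : ℕ} (R : Fin r → ℝ) (f : (Fin r → ℂ) → ℂ) : ℂ :=
  ∫ θ : Fin r → UnitAddCircle, f (torusPoint R θ)

lemma continuous_circlePoint (ρ : ℝ) : Continuous (circlePoint ρ) := by
  have := AddCircle.continuous_toCircle (T := (1 : ℝ))
  unfold circlePoint
  fun_prop

lemma norm_circlePoint (ρ : ℝ) (θ : UnitAddCircle) : ‖circlePoint ρ θ‖ = |ρ| := by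
  rw [circlePoint, norm_mul, Circle.norm_coe, mul_one, Complex.norm_real, Real.norm_eq_abs]

lemma continuous_torusPoint {r : ℕ} (R : Fin r → ℝ) : Continuous (torusPoint R) :=
  continuous_pi fun i => (continuous_circlePoint (R i)).comp (continuous_apply i)

lemma circlePoint_neg (ρ : ℝ) (θ : UnitAddCircle) :
    circlePoint ρ (-θ) = (circlePoint ρ⁻¹ θ)⁻¹ := by
  simp [circlePoint, AddCircle.toCircle_neg, mul_comm]

lemma integral_circlePoint (ρ : ℝ) (f : ℂ → ℂ) :
    ∫ θ : UnitAddCircle, f (circlePoint ρ θ) = Real.circleAverage f 0 ρ := by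
  rw [← UnitAddCircle.integral_preimage 0, Real.circleAverage,
    ← intervalIntegral.integral_of_le (by simp)]
  have := intervalIntegral.integral_comp_mul_left (a := 0) (b := 1)
    (fun θ => f (circleMap 0 ρ θ)) (c := 2 * Real.pi) (by positivity)
  simp only [mul_zero, mul_one] at this
  rw [zero_add, ← this]
  refine intervalIntegral.integral_congr fun x _ => ?_
  simp [circlePoint, AddCircle.toCircle_apply_mk, circleMap, Circle.coe_exp]

/-- The mean value property. -/
lemma integral_circlePoint_of_diffContOnCl {ρ : ℝ} (hρ : 0 < ρ) {f : ℂ → ℂ}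
    (hf : DiffContOnCl ℂ f (Metric.ball 0 ρ)) :
    ∫ θ : UnitAddCircle, f (circlePoint ρ θ) = f 0 := by
  rw [integral_circlePoint]
  exact DiffContOnCl.circleAverage (by rwa [abs_of_pos hρ])

/-- Haar measure on the circle is invariant under `θ ↦ -θ`. This moves a function holomorphic near
infinity to a disc around `0`, where the mean value property applies. -/
lemma integral_circlePoint_inv (ρ : ℝ) (f : ℂ → ℂ) :
    ∫ θ : UnitAddCircle, f (circlePoint ρ θ) =
      ∫ θ : UnitAddCircle, f (circlePoint ρ⁻¹ θ)⁻¹ := by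
  rw [← integral_neg_eq_self]
  simp_rw [circlePoint_neg]

/-- Up to a constant, `z h'(z) dθ` is the exact form `h'(z) dz` on a closed curve. The primitive is
needed only on the circle, so `h` may have poles inside. -/
lemma integral_circlePoint_mul_deriv {ρ : ℝ} (hρ : 0 < ρ) {h h' : ℂ → ℂ}
    (hh : ∀ z ∈ Metric.sphere (0 : ℂ) ρ, HasDerivAt h (h' z) z) :
    ∫ θ : UnitAddCircle, circlePoint ρ θ * h' (circlePoint ρ θ) = 0 := by
  rw [integral_circlePoint ρ (fun z => z * h' z), Real.circleAverage_eq_circleIntegral hρ.ne']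
  have : ∮ z in C(0, ρ), (z - 0)⁻¹ • (z * h' z) = ∮ z in C(0, ρ), h' z := by
    refine circleIntegral.integral_congr hρ.le fun z hz => ?_
    have hz0 : z ≠ 0 := by
      rintro rfl
      simp at hz
      exact hρ.ne hz
    simp [hz0]
  rw [this, circleIntegral.integral_eq_zero_of_hasDerivWithinAt' (f := h), smul_zero]
  intro z hz
  rw [abs_of_pos hρ] at hz
  exact (hh z hz).hasDerivWithinAt

/-- Permuting the variables permutes the radii. The result is a genuinely different constant term
when the integrand has poles on the diagonals. -/
lemma constantTerm_comp_perm {r : ℕ} (R : Fin r → ℝ) (σ : Equiv.Perm (Fin r))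
    (f : (Fin r → ℂ) → ℂ) :
    constantTerm R (fun x => f (x ∘ σ)) = constantTerm (R ∘ σ) f := by
  have h := (volume_measurePreserving_piCongrLeft (fun _ : Fin r => UnitAddCircle) σ).integral_comp
    (MeasurableEquiv.measurableEmbedding _) (fun θ => f (torusPoint R θ ∘ σ))
  rw [constantTerm, ← h, constantTerm]
  refine integral_congr_ae (Filter.Eventually.of_forall fun θ => ?_)
  dsimp only
  congr 1
  ext i
  simp only [torusPoint, Function.comp_apply]
  congr 1
  exact Equiv.piCongrLeft_apply_apply (fun _ : Fin r => UnitAddCircle) σ θ i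

lemma torusPoint_insertNth {r : ℕ} (R : Fin (r + 1) → ℝ) (i : Fin (r + 1)) (θ : UnitAddCircle)
    (θ' : Fin r → UnitAddCircle) :
    torusPoint R (i.insertNth θ θ') =
      i.insertNth (circlePoint (R i) θ) (torusPoint (R ∘ i.succAbove) θ') := by
  ext j
  refine Fin.succAboveCases i ?_ (fun k => ?_) j
  · simp [torusPoint]
  · simp [torusPoint]

lemma constantTerm_succAbove {r : ℕ} (R : Fin (r + 1) → ℝ) (i : Fin (r + 1))
    (f : (Fin (r + 1) → ℂ) → ℂ) (hf : Continuous fun θ => f (torusPoint R θ)) :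
    constantTerm R f = ∫ θ' : Fin r → UnitAddCircle, ∫ θ : UnitAddCircle,
      f (i.insertNth (circlePoint (R i) θ) (torusPoint (R ∘ i.succAbove) θ')) := by
  have h := (volume_preserving_piFinSuccAbove (fun _ : Fin (r + 1) => UnitAddCircle) i).symm
  have hi : Integrable (fun θ => f (torusPoint R θ)) :=
    hf.integrable_of_hasCompactSupport (HasCompactSupport.of_compactSpace _)
  rw [constantTerm, ← h.integral_comp (MeasurableEquiv.measurableEmbedding _)]
  rw [← h.integrable_comp_emb (MeasurableEquiv.measurableEmbedding _)] at hi
  rw [Measure.volume_eq_prod] at hi ⊢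
  refine (integral_prod_symm _ hi).trans ?_
  refine integral_congr_ae (Filter.Eventually.of_forall fun θ' => ?_)
  refine integral_congr_ae (Filter.Eventually.of_forall fun θ => ?_)
  exact congrArg f (torusPoint_insertNth R i θ _)

/-! ### Distinct radii and alternating densities. -/

/-- Points of `ℂ^r` with distinct coordinates, none of them `0` or `1`. -/
def distinctPoints (r : ℕ) : Set (Fin r → ℂ) :=
  {x | Function.Injective x ∧ ∀ i, x i ≠ 0 ∧ x i ≠ 1}

/-- Distinct positive radii smaller than `1`. -/
def IsRadii {r : ℕ} (R : Fin r → ℝ) : Prop :=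
  Function.Injective R ∧ ∀ i, 0 < R i ∧ R i < 1

lemma IsRadii.comp {r s : ℕ} {R : Fin r → ℝ} (hR : IsRadii R) {σ : Fin s → Fin r}
    (hσ : Function.Injective σ) : IsRadii (R ∘ σ) :=
  ⟨hR.1.comp hσ, fun i => hR.2 (σ i)⟩

lemma IsRadii.torusPoint_mem {r : ℕ} {R : Fin r → ℝ} (hR : IsRadii R)
    (θ : Fin r → UnitAddCircle) : torusPoint R θ ∈ distinctPoints r := by
  have h : ∀ i, ‖torusPoint R θ i‖ = R i := fun i => by
    rw [torusPoint, norm_circlePoint, abs_of_pos (hR.2 i).1]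
  refine ⟨fun i j hij => hR.1 ?_, fun i => ⟨fun h0 => ?_, fun h1 => ?_⟩⟩
  · rw [← h i, ← h j, hij]
  · have := h i
    rw [h0, norm_zero] at this
    exact (hR.2 i).1.ne this
  · have := h i
    rw [h1, norm_one] at this
    exact (hR.2 i).2.ne' this

lemma IsRadii.continuous {r : ℕ} {R : Fin r → ℝ} (hR : IsRadii R) {f : (Fin r → ℂ) → ℂ}
    (hf : ContinuousOn f (distinctPoints r)) : Continuous fun θ => f (torusPoint R θ) :=
  hf.comp_continuous (continuous_torusPoint R) hR.torusPoint_mem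

lemma IsRadii.integrable {r : ℕ} {R : Fin r → ℝ} (hR : IsRadii R) {f : (Fin r → ℂ) → ℂ}
    (hf : ContinuousOn f (distinctPoints r)) : Integrable fun θ => f (torusPoint R θ) :=
  (hR.continuous hf).integrable_of_hasCompactSupport (HasCompactSupport.of_compactSpace _)

/-- The inverse of the Vandermonde product, `∏_{i<j} (x_i - x_j)⁻¹`. -/
def vandermondeInv {r : ℕ} (x : Fin r → ℂ) : ℂ :=
  ∏ i, ∏ j, if i < j then (x i - x j)⁻¹ else 1

/-- As a determinant, the product inherits antisymmetry from permutation of rows; the sign in `-x`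
turns the factors `xⱼ - xᵢ` of Mathlib into `xᵢ - xⱼ`. -/
lemma vandermondeInv_eq_det {r : ℕ} (x : Fin r → ℂ) :
    vandermondeInv x = (Matrix.vandermonde (-x)).det⁻¹ := by
  rw [Matrix.det_vandermonde, vandermondeInv, ← Finset.prod_inv_distrib]
  refine Finset.prod_congr rfl fun i _ => ?_
  rw [← Finset.prod_inv_distrib, ← Finset.prod_filter]
  refine Finset.prod_congr (by ext; simp) fun j _ => ?_
  simp only [Pi.neg_apply]
  congr 1
  ring

lemma vandermondeInv_comp_perm {r : ℕ} (x : Fin r → ℂ) (σ : Equiv.Perm (Fin r)) :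
    vandermondeInv (x ∘ σ) = ((Equiv.Perm.sign σ : ℤ) : ℂ) * vandermondeInv x := by
  rw [vandermondeInv_eq_det, vandermondeInv_eq_det]
  have : Matrix.vandermonde (-(x ∘ σ)) = (Matrix.vandermonde (-x)).submatrix σ id := by
    ext i j
    simp [Matrix.vandermonde_apply]
  rw [this, Matrix.det_permute, mul_inv]
  congr 1
  rcases Int.units_eq_one_or (Equiv.Perm.sign σ) with h | h <;> simp [h]

lemma vandermondeInv_cons {r : ℕ} (z : ℂ) (y : Fin r → ℂ) :
    vandermondeInv (Fin.cons z y : Fin (r + 1) → ℂ) = (∏ j, (z - y j)⁻¹) * vandermondeInv y := by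
  simp [vandermondeInv, Fin.prod_univ_succ]

lemma vandermondeInv_snoc {r : ℕ} (y : Fin r → ℂ) (z : ℂ) :
    vandermondeInv (Fin.snoc y z : Fin (r + 1) → ℂ) = vandermondeInv y * ∏ j, (y j - z)⁻¹ := by
  simp [vandermondeInv, Fin.prod_univ_castSucc, Finset.prod_mul_distrib,
    Fin.not_lt.2 (Fin.le_last _)]

lemma continuousOn_vandermondeInv (r : ℕ) :
    ContinuousOn (vandermondeInv (r := r)) {x | Function.Injective x} := by
  refine continuousOn_finsetProd _ fun i _ => continuousOn_finsetProd _ fun j _ => ?_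
  split_ifs with hij
  · exact ContinuousOn.inv₀ (by fun_prop) fun x hx => sub_ne_zero.2 fun h => hij.ne (hx h)
  · exact continuousOn_const

/-- The density `∏ xᵢ⁻¹ (1 - xᵢ)⁻¹ ∏_{i<j} (xᵢ - xⱼ)⁻¹`. -/
def morrisDensity {r : ℕ} (x : Fin r → ℂ) : ℂ :=
  (∏ i, ((x i)⁻¹ * (1 - x i)⁻¹)) * vandermondeInv x

lemma continuousOn_morrisDensity (r : ℕ) :
    ContinuousOn (morrisDensity (r := r)) (distinctPoints r) := by
  refine ContinuousOn.mul (continuousOn_finsetProd _ fun i _ => ContinuousOn.mul ?_ ?_)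
    ((continuousOn_vandermondeInv r).mono fun x hx => hx.1)
  · exact ContinuousOn.inv₀ (by fun_prop) fun x hx => (hx.2 i).1
  · exact ContinuousOn.inv₀ (by fun_prop) fun x hx => sub_ne_zero.2 (hx.2 i).2.symm

lemma morrisDensity_comp_perm {r : ℕ} (x : Fin r → ℂ) (σ : Equiv.Perm (Fin r)) :
    morrisDensity (x ∘ σ) = ((Equiv.Perm.sign σ : ℤ) : ℂ) * morrisDensity x := by
  rw [morrisDensity, morrisDensity, vandermondeInv_comp_perm]
  rw [show ∏ i, (((x ∘ σ) i)⁻¹ * (1 - (x ∘ σ) i)⁻¹) = ∏ i, ((x i)⁻¹ * (1 - x i)⁻¹) from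
    Equiv.prod_comp σ (fun i => (x i)⁻¹ * (1 - x i)⁻¹)]
  ring

lemma comp_perm_mem_distinctPoints {r : ℕ} {x : Fin r → ℂ} (hx : x ∈ distinctPoints r)
    (σ : Equiv.Perm (Fin r)) : x ∘ σ ∈ distinctPoints r :=
  ⟨hx.1.comp σ.injective, fun i => hx.2 (σ i)⟩

lemma ContinuousOn.comp_perm {r : ℕ} {f : (Fin r → ℂ) → ℂ}
    (hf : ContinuousOn f (distinctPoints r)) (σ : Equiv.Perm (Fin r)) :
    ContinuousOn (fun x => f (x ∘ σ)) (distinctPoints r) :=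
  hf.comp (by fun_prop) fun _ hx => comp_perm_mem_distinctPoints hx σ

/-! ### Antisymmetrization over the orders of the radii. -/

/-- The alternating sum of the constant terms of `f` over all orders of the radii. -/
def alternatingTerm {r : ℕ} (R : Fin r → ℝ) (f : (Fin r → ℂ) → ℂ) : ℂ :=
  ∑ σ : Equiv.Perm (Fin r), ((Equiv.Perm.sign σ : ℤ) : ℂ) * constantTerm (R ∘ σ) f

section alternating

variable {r : ℕ} {R : Fin r → ℝ}

lemma IsRadii.comp_perm (hR : IsRadii R) (σ : Equiv.Perm (Fin r)) : IsRadii (R ∘ σ) :=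
  hR.comp σ.injective

lemma constantTerm_congr (hR : IsRadii R) {f g : (Fin r → ℂ) → ℂ}
    (h : Set.EqOn f g (distinctPoints r)) : constantTerm R f = constantTerm R g :=
  integral_congr_ae (Filter.Eventually.of_forall fun θ => h (hR.torusPoint_mem θ))

lemma alternatingTerm_congr (hR : IsRadii R) {f g : (Fin r → ℂ) → ℂ}
    (h : Set.EqOn f g (distinctPoints r)) : alternatingTerm R f = alternatingTerm R g :=
  Finset.sum_congr rfl fun σ _ => by rw [constantTerm_congr (hR.comp_perm σ) h]

lemma alternatingTerm_add (hR : IsRadii R) {f g : (Fin r → ℂ) → ℂ}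
    (hf : ContinuousOn f (distinctPoints r)) (hg : ContinuousOn g (distinctPoints r)) :
    alternatingTerm R (fun x => f x + g x) = alternatingTerm R f + alternatingTerm R g := by
  simp only [alternatingTerm, ← Finset.sum_add_distrib, ← mul_add]
  refine Finset.sum_congr rfl fun σ _ => ?_
  congr 1
  exact integral_add ((hR.comp_perm σ).integrable hf) ((hR.comp_perm σ).integrable hg)

lemma alternatingTerm_const_mul (c : ℂ) (f : (Fin r → ℂ) → ℂ) :
    alternatingTerm R (fun x => c * f x) = c * alternatingTerm R f := by
  simp only [alternatingTerm, Finset.mul_sum]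
  refine Finset.sum_congr rfl fun σ _ => ?_
  rw [constantTerm, integral_const_mul, constantTerm]
  ring

lemma alternatingTerm_sub (hR : IsRadii R) {f g : (Fin r → ℂ) → ℂ}
    (hf : ContinuousOn f (distinctPoints r)) (hg : ContinuousOn g (distinctPoints r)) :
    alternatingTerm R (fun x => f x - g x) = alternatingTerm R f - alternatingTerm R g := by
  have := alternatingTerm_add hR (g := fun x => (-1) * g x) hf (continuousOn_const.mul hg)
  rw [alternatingTerm_const_mul] at this
  simpa [sub_eq_add_neg] using this

lemma alternatingTerm_sum (hR : IsRadii R) {ι : Type*} (s : Finset ι) {f : ι → (Fin r → ℂ) → ℂ}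
    (hf : ∀ i ∈ s, ContinuousOn (f i) (distinctPoints r)) :
    alternatingTerm R (fun x => ∑ i ∈ s, f i x) = ∑ i ∈ s, alternatingTerm R (f i) := by
  simp only [alternatingTerm]
  rw [Finset.sum_comm]
  refine Finset.sum_congr rfl fun σ _ => ?_
  rw [← Finset.mul_sum]
  congr 1
  exact integral_finsetSum _ fun i hi => (hR.comp_perm σ).integrable (hf i hi)

lemma alternatingTerm_comp_perm (τ : Equiv.Perm (Fin r)) (f : (Fin r → ℂ) → ℂ) :
    alternatingTerm R (fun x => f (x ∘ τ)) =
      ((Equiv.Perm.sign τ : ℤ) : ℂ) * alternatingTerm R f := by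
  simp only [alternatingTerm, constantTerm_comp_perm, Finset.mul_sum]
  refine Fintype.sum_equiv (Equiv.mulRight τ) _ _ fun σ => ?_
  rw [show R ∘ (Equiv.mulRight τ σ) = (R ∘ σ) ∘ τ from rfl, ← mul_assoc]
  congr 1
  simp only [Equiv.coe_mulRight, Equiv.Perm.sign_mul]
  rcases Int.units_eq_one_or (Equiv.Perm.sign τ) with h | h <;> simp [h]

/-- The sign from reindexing the alternating sum cancels the sign of the density. The functional on
`P` is therefore invariant under permutation of variables, which a single torus does not give. -/
lemma alternatingTerm_morris_comp_perm (τ : Equiv.Perm (Fin r))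
    (P : (Fin r → ℂ) → ℂ) :
    alternatingTerm R (fun x => morrisDensity x * P (x ∘ τ)) =
      alternatingTerm R (fun x => morrisDensity x * P x) := by
  have h := alternatingTerm_comp_perm (R := R) τ (fun x => morrisDensity x * P x)
  simp only [morrisDensity_comp_perm, mul_assoc, alternatingTerm_const_mul] at h
  rcases Int.units_eq_one_or (Equiv.Perm.sign τ) with hτ | hτ <;> simpa [hτ] using h

/-- For symmetric `P` every order of the radii contributes equally, so the constant term on one
torus can be recovered at the end. -/
lemma alternatingTerm_of_symmetric (P : (Fin r → ℂ) → ℂ)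
    (hP : ∀ x, ∀ σ : Equiv.Perm (Fin r), P (x ∘ σ) = P x) :
    alternatingTerm R (fun x => morrisDensity x * P x) =
      r.factorial * constantTerm R (fun x => morrisDensity x * P x) := by
  have : ∀ σ : Equiv.Perm (Fin r), ((Equiv.Perm.sign σ : ℤ) : ℂ) *
      constantTerm (R ∘ σ) (fun x => morrisDensity x * P x) =
      constantTerm R (fun x => morrisDensity x * P x) := fun σ => by
    rw [← constantTerm_comp_perm]
    simp only [morrisDensity_comp_perm, hP, mul_assoc]
    rw [constantTerm, integral_const_mul, ← mul_assoc, constantTerm]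
    rcases Int.units_eq_one_or (Equiv.Perm.sign σ) with h | h <;> simp [h]
  simp [alternatingTerm, this, Fintype.card_perm]

/-- Averaging `P` over a transposition is what removes the poles of `x 0 / (x 0 - x j)` in Aomoto's
argument. -/
lemma two_mul_alternatingTerm_morris (hR : IsRadii R) (τ : Equiv.Perm (Fin r))
    {P : (Fin r → ℂ) → ℂ} (hP : ContinuousOn P (distinctPoints r)) :
    2 * alternatingTerm R (fun x => morrisDensity x * P x) =
      alternatingTerm R (fun x => morrisDensity x * (P x + P (x ∘ τ))) := by
  simp only [mul_add]
  rw [alternatingTerm_add hR ((continuousOn_morrisDensity r).fun_mul hP)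
    ((continuousOn_morrisDensity r).fun_mul (hP.comp_perm τ)), alternatingTerm_morris_comp_perm]
  ring

lemma alternatingTerm_prod_eq_of_card_eq {s t : Finset (Fin r)}
    (h : s.card = t.card) :
    alternatingTerm R (fun x => morrisDensity x * ∏ i ∈ s, x i) =
      alternatingTerm R (fun x => morrisDensity x * ∏ i ∈ t, x i) := by
  obtain ⟨σ, hσ⟩ := Equiv.Perm.exists_map_finset_eq s t h
  rw [← alternatingTerm_morris_comp_perm σ]
  subst hσ
  simp

end alternating

/-! ### Aomoto's recursion. -/

lemma hasDerivAt_inv_mul_prod_sub_inv {r : ℕ} (y : Fin r → ℂ) {z : ℂ} (hz : z ≠ 0)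
    (hy : ∀ j, z ≠ y j) :
    HasDerivAt (fun z => z⁻¹ * ∏ j, (z - y j)⁻¹)
      (-z⁻¹ * (z⁻¹ * (∏ j, (z - y j)⁻¹) * (1 + ∑ j, z / (z - y j)))) z := by
  have h1 : HasDerivAt (fun z => ∏ j, (z - y j)⁻¹)
      (∑ j, (∏ k ∈ Finset.univ.erase j, (z - y k)⁻¹) • (-1 / (z - y j) ^ 2)) z :=
    HasDerivAt.fun_finsetProd fun j _ =>
      ((hasDerivAt_id z).sub_const (y j)).fun_inv (sub_ne_zero.2 (hy j))
  refine ((hasDerivAt_inv hz).mul h1).congr_deriv ?_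
  have h2 : ∀ j, (∏ k ∈ Finset.univ.erase j, (z - y k)⁻¹) • (-1 / (z - y j) ^ 2) =
      -(∏ k, (z - y k)⁻¹) * (z - y j)⁻¹ := fun j => by
    rw [← Finset.mul_prod_erase Finset.univ _ (Finset.mem_univ j)]
    have := sub_ne_zero.2 (hy j)
    simp only [smul_eq_mul]
    field_simp
  simp_rw [h2, ← Finset.mul_sum, div_eq_mul_inv, ← Finset.mul_sum]
  field_simp
  ring

/-- The factor `1 - z` removes the pole at `1` and leaves exactly the function differentiated above.
-/
lemma morrisDensity_cons_mul {r : ℕ} {z : ℂ} (y : Fin r → ℂ) (hz : z ≠ 1) :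
    morrisDensity (Fin.cons z y : Fin (r + 1) → ℂ) * (1 - z) =
      morrisDensity y * (z⁻¹ * ∏ j, (z - y j)⁻¹) := by
  have : 1 - z ≠ 0 := sub_ne_zero.2 hz.symm
  rw [morrisDensity, morrisDensity, vandermondeInv_cons, Fin.prod_univ_succ]
  simp only [Fin.cons_zero, Fin.cons_succ]
  field_simp

lemma continuousOn_div_sub {r : ℕ} (j : Fin r) :
    ContinuousOn (fun x : Fin (r + 1) → ℂ => x 0 / (x 0 - x j.succ)) (distinctPoints (r + 1)) :=
  ContinuousOn.div (by fun_prop) (by fun_prop) fun _ hx =>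
    sub_ne_zero.2 fun h => (Fin.succ_ne_zero j).symm (hx.1 h)

section aomoto

variable {r : ℕ} {R : Fin (r + 1) → ℝ}

/-- Stokes formula for the Euler derivative in the first variable. -/
lemma constantTerm_euler (hR : IsRadii R) (s : Finset (Fin (r + 1))) (hs : 0 ∉ s) :
    constantTerm R (fun x => morrisDensity x * ((1 - x 0) * (∏ i ∈ s, x i) *
      (1 + ∑ j : Fin r, x 0 / (x 0 - x j.succ)))) = 0 := by
  rw [constantTerm_succAbove R 0]
  · refine integral_eq_zero_of_ae (Filter.Eventually.of_forall fun θ' => ?_)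
    simp only [Pi.zero_apply]
    set y := torusPoint (R ∘ Fin.succAbove 0) θ' with hy
    -- Since `0 ∉ s`, the monomial does not involve the integration variable and may be pulled out
    -- as a constant.
    have hs' : ∀ z : ℂ, ∏ i ∈ s, (Fin.insertNth 0 z y : Fin (r + 1) → ℂ) i =
        ∏ i ∈ s, (Fin.insertNth 0 0 y : Fin (r + 1) → ℂ) i := fun z =>
      Finset.prod_congr rfl fun i hi => by
        obtain ⟨j, rfl⟩ := Fin.exists_succ_eq.2 (fun h : i = 0 => hs (h ▸ hi))
        simp
    have hpos := (hR.2 0).1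
    have hder := integral_circlePoint_mul_deriv hpos
      (h := fun z => z⁻¹ * ∏ j, (z - y j)⁻¹)
      (h' := fun z => -z⁻¹ * (z⁻¹ * (∏ j, (z - y j)⁻¹) * (1 + ∑ j, z / (z - y j))))
      (fun z hz => by
        have hz' : ‖z‖ = R 0 := by simpa using hz
        refine hasDerivAt_inv_mul_prod_sub_inv y ?_ fun j h => ?_
        · rintro rfl
          rw [norm_zero] at hz'
          exact hpos.ne hz'
        · have : ‖y j‖ = R (Fin.succ j) := by
            rw [hy, torusPoint, norm_circlePoint, Function.comp_apply, abs_of_pos (hR.2 _).1,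
              Fin.zero_succAbove]
          rw [← h, hz'] at this
          exact (Fin.succ_ne_zero j).symm (hR.1 this))
    rw [← mul_eq_zero_of_right
      (-(morrisDensity y * ∏ i ∈ s, (Fin.insertNth 0 0 y : Fin (r + 1) → ℂ) i)) hder,
      ← integral_const_mul]
    refine integral_congr_ae (Filter.Eventually.of_forall fun θ => ?_)
    have hn := norm_circlePoint (R 0) θ
    rw [abs_of_pos hpos] at hn
    dsimp only
    set z := circlePoint (R 0) θ
    have hz0 : z ≠ 0 := by
      rintro h
      rw [h, norm_zero] at hn
      exact hpos.ne hn
    have hz1 : z ≠ 1 := by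
      rintro h
      rw [h, norm_one] at hn
      exact (hR.2 0).2.ne' hn
    rw [hs']
    generalize ∏ i ∈ s, (Fin.insertNth 0 0 y : Fin (r + 1) → ℂ) i = Q
    have hins : (Fin.insertNth 0 z y : Fin (r + 1) → ℂ) = Fin.cons z y := by
      simp
    rw [hins]
    simp only [Fin.cons_zero, Fin.cons_succ]
    have := morrisDensity_cons_mul y hz1
    calc _ = morrisDensity (Fin.cons z y : Fin (r + 1) → ℂ) * (1 - z) * Q *
          (1 + ∑ j, z / (z - y j)) := by ring
      _ = _ := by
        rw [this]
        field_simp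
  · refine hR.continuous ((continuousOn_morrisDensity _).mul (ContinuousOn.mul
      (f := fun x : Fin (r + 1) → ℂ => (1 - x 0) * ∏ i ∈ s, x i) (by fun_prop)
      (continuousOn_const.add (continuousOn_finsetSum _ fun j _ => continuousOn_div_sub j))))

/-- After symmetrizing under `0 ↔ j`, the pole cancels: `x₀ xⱼ ((1 - x₀) - (1 - xⱼ)) / (x₀ - xⱼ) =
-x₀ xⱼ`. -/
lemma two_mul_alternatingTerm_of_mem (hR : IsRadii R) {s : Finset (Fin (r + 1))} (hs : 0 ∉ s)
    {j : Fin r} (hj : j.succ ∈ s) :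
    2 * alternatingTerm R (fun x => morrisDensity x * ((1 - x 0) * (∏ i ∈ s, x i) *
      (x 0 / (x 0 - x j.succ)))) =
    -alternatingTerm R (fun x => morrisDensity x * ∏ i ∈ insert 0 s, x i) := by
  rw [two_mul_alternatingTerm_morris hR (Equiv.swap 0 j.succ)
    (P := fun x => (1 - x 0) * (∏ i ∈ s, x i) * (x 0 / (x 0 - x j.succ)))
    (ContinuousOn.mul (by fun_prop) (continuousOn_div_sub j)),
    ← neg_one_mul, ← alternatingTerm_const_mul]
  refine alternatingTerm_congr hR fun x hx => ?_
  have hne : x 0 - x j.succ ≠ 0 := sub_ne_zero.2 fun h => (Fin.succ_ne_zero j).symm (hx.1 h)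
  have hne' : x j.succ - x 0 ≠ 0 := sub_ne_zero.2 fun h => (Fin.succ_ne_zero j) (hx.1 h)
  have h1 : ∏ i ∈ s.erase j.succ, x (Equiv.swap 0 j.succ i) = ∏ i ∈ s.erase j.succ, x i :=
    Finset.prod_congr rfl fun i hi => by
      rw [Equiv.swap_apply_of_ne_of_ne]
      · rintro rfl
        exact hs (Finset.mem_of_mem_erase hi)
      · exact Finset.ne_of_mem_erase hi
  simp only [Function.comp_apply, Equiv.swap_apply_left, Equiv.swap_apply_right]
  rw [Finset.prod_insert hs, ← Finset.mul_prod_erase s _ hj, ← Finset.mul_prod_erase s _ hj, h1,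
    Equiv.swap_apply_right]
  field_simp
  ring

/-- Here symmetrizing gives `(x₀(1 - x₀) - xⱼ(1 - xⱼ)) / (x₀ - xⱼ) = 1 - x₀ - xⱼ`. The last two
terms lead to monomials of equal degree, hence equal alternating terms. -/
lemma two_mul_alternatingTerm_of_notMem (hR : IsRadii R) {s : Finset (Fin (r + 1))} (hs : 0 ∉ s)
    {j : Fin r} (hj : j.succ ∉ s) :
    2 * alternatingTerm R (fun x => morrisDensity x * ((1 - x 0) * (∏ i ∈ s, x i) *
      (x 0 / (x 0 - x j.succ)))) =
    alternatingTerm R (fun x => morrisDensity x * ∏ i ∈ s, x i) -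
      2 * alternatingTerm R (fun x => morrisDensity x * ∏ i ∈ insert 0 s, x i) := by
  have hc : ∀ t : Finset (Fin (r + 1)), ContinuousOn (fun x : Fin (r + 1) → ℂ =>
      morrisDensity x * ∏ i ∈ t, x i) (distinctPoints (r + 1)) := fun t =>
    (continuousOn_morrisDensity _).mul (by fun_prop)
  have hcard : (insert 0 s).card = (insert j.succ s).card := by
    rw [Finset.card_insert_of_notMem hs, Finset.card_insert_of_notMem hj]
  rw [two_mul_alternatingTerm_morris hR (Equiv.swap 0 j.succ)
    (P := fun x => (1 - x 0) * (∏ i ∈ s, x i) * (x 0 / (x 0 - x j.succ)))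
    (ContinuousOn.mul (by fun_prop) (continuousOn_div_sub j))]
  have hsub : ∀ a b b' : ℂ, b = b' → a - b - b' = a - 2 * b := by
    rintro a b _ rfl
    ring
  refine Eq.trans ?_ (hsub _ _ _ (alternatingTerm_prod_eq_of_card_eq hcard))
  rw [← alternatingTerm_sub hR (hc _) (hc _),
    ← alternatingTerm_sub hR ((hc _).fun_sub (hc _)) (hc _)]
  refine alternatingTerm_congr hR fun x hx => ?_
  have hne : x 0 - x j.succ ≠ 0 := sub_ne_zero.2 fun h => (Fin.succ_ne_zero j).symm (hx.1 h)
  have hne' : x j.succ - x 0 ≠ 0 := sub_ne_zero.2 fun h => (Fin.succ_ne_zero j) (hx.1 h)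
  have h1 : ∏ i ∈ s, x (Equiv.swap 0 j.succ i) = ∏ i ∈ s, x i :=
    Finset.prod_congr rfl fun i hi => by
      rw [Equiv.swap_apply_of_ne_of_ne]
      · rintro rfl
        exact hs hi
      · rintro rfl
        exact hj hi
  simp only [Function.comp_apply, Equiv.swap_apply_left, Equiv.swap_apply_right]
  rw [Finset.prod_insert hs, Finset.prod_insert hj, h1]
  field_simp
  ring

/-- The recursion of Aomoto. -/
lemma alternatingTerm_insert (hR : IsRadii R) {s : Finset (Fin (r + 1))} (hs : 0 ∉ s) :
    ((r : ℂ) + 2 - s.card) * alternatingTerm R (fun x => morrisDensity x * ∏ i ∈ s, x i) =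
      (2 * r + 2 - s.card) *
        alternatingTerm R (fun x => morrisDensity x * ∏ i ∈ insert 0 s, x i) := by
  have h0 : alternatingTerm R (fun x => morrisDensity x * ((1 - x 0) * (∏ i ∈ s, x i) *
      (1 + ∑ j : Fin r, x 0 / (x 0 - x j.succ)))) = 0 :=
    Finset.sum_eq_zero fun σ _ => by
      rw [constantTerm_euler (hR.comp_perm σ) s hs, mul_zero]
  have hc : ∀ t : Finset (Fin (r + 1)), ContinuousOn (fun x : Fin (r + 1) → ℂ =>
      morrisDensity x * ∏ i ∈ t, x i) (distinctPoints (r + 1)) := fun t =>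
    (continuousOn_morrisDensity _).mul (by fun_prop)
  have hd : ∀ j : Fin r, ContinuousOn (fun x : Fin (r + 1) → ℂ => morrisDensity x *
      ((1 - x 0) * (∏ i ∈ s, x i) * (x 0 / (x 0 - x j.succ)))) (distinctPoints (r + 1)) :=
    fun j => (continuousOn_morrisDensity _).mul
      (ContinuousOn.mul (by fun_prop) (continuousOn_div_sub j))
  set a := alternatingTerm R (fun x => morrisDensity x * ∏ i ∈ s, x i)
  set b := alternatingTerm R (fun x => morrisDensity x * ∏ i ∈ insert 0 s, x i)
  have h1 : alternatingTerm R (fun x => morrisDensity x * ((1 - x 0) * (∏ i ∈ s, x i) *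
      (1 + ∑ j : Fin r, x 0 / (x 0 - x j.succ)))) = a - b +
      ∑ j : Fin r, alternatingTerm R (fun x => morrisDensity x * ((1 - x 0) * (∏ i ∈ s, x i) *
        (x 0 / (x 0 - x j.succ)))) := by
    rw [← alternatingTerm_sum hR _ fun j _ => hd j, ← alternatingTerm_sub hR (hc _) (hc _),
      ← alternatingTerm_add hR ((hc _).fun_sub (hc _)) (continuousOn_finsetSum _ fun j _ => hd j)]
    refine alternatingTerm_congr hR fun x hx => ?_
    rw [← Finset.mul_sum, ← Finset.mul_sum, Finset.prod_insert hs]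
    ring
  have h2 : ∀ j : Fin r, 2 * alternatingTerm R (fun x => morrisDensity x *
      ((1 - x 0) * (∏ i ∈ s, x i) * (x 0 / (x 0 - x j.succ)))) =
      (a - 2 * b) + if j.succ ∈ s then b - a else 0 := fun j => by
    split_ifs with hj
    · rw [two_mul_alternatingTerm_of_mem hR hs hj]
      ring
    · rw [two_mul_alternatingTerm_of_notMem hR hs hj, add_zero]
  have h3 : ∑ j : Fin r, (if j.succ ∈ s then b - a else 0) = s.card * (b - a) := by
    have : ∑ i : Fin (r + 1), (if i ∈ s then b - a else 0) = s.card * (b - a) := by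
      simp [mul_sub]
    rw [Fin.sum_univ_succ, if_neg hs, zero_add] at this
    exact this
  -- With `k = s.card`, twice the Stokes relation reads `2(a - b) + r(a - 2b) + k(b - a) = 0`.
  have h4 := congrArg (2 * ·) (h1.symm.trans h0)
  simp only [mul_add, Finset.mul_sum, h2, Finset.sum_add_distrib, h3, Finset.sum_const,
    Finset.card_univ, Fintype.card_fin, nsmul_eq_mul, mul_zero] at h4
  linear_combination h4

end aomoto

/-! ### The Morris constant term and the product of Catalan numbers. -/

/-- `∏ (1 - xᵢ)⁻¹ ∏_{i<j} (xᵢ - xⱼ)⁻¹`. -/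
def flowDensity {r : ℕ} (x : Fin r → ℂ) : ℂ := (∏ i, (1 - x i)⁻¹) * vandermondeInv x

lemma continuousOn_flowDensity (r : ℕ) :
    ContinuousOn (flowDensity (r := r)) (distinctPoints r) := by
  refine ContinuousOn.mul (continuousOn_finsetProd _ fun i _ => ?_)
    ((continuousOn_vandermondeInv r).mono fun x hx => hx.1)
  exact ContinuousOn.inv₀ (by fun_prop) fun x hx => sub_ne_zero.2 (hx.2 i).2.symm

lemma morrisDensity_mul_prod {r : ℕ} {x : Fin r → ℂ} (hx : x ∈ distinctPoints r) :
    morrisDensity x * ∏ i, x i = flowDensity x := by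
  rw [morrisDensity, flowDensity, mul_right_comm, ← Finset.prod_mul_distrib]
  congr 1
  refine Finset.prod_congr rfl fun i _ => ?_
  have := (hx.2 i).1
  field_simp

/-- The case of the constant term identity of Morris behind the appearance of Catalan numbers. -/
lemma constantTerm_morrisDensity {r : ℕ} {R : Fin r → ℝ} (hR : IsRadii R) :
    constantTerm R morrisDensity = catalan r * constantTerm R flowDensity := by
  rcases r with _ | r
  · simp [constantTerm, morrisDensity, flowDensity]
  -- Iterated recursion: the factors `r + 2 - k` and `2r + 2 - k` accumulate to falling factorials.
  -- Only the size of `s` matters, so each step may switch to a set avoiding `0`.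
  have key : ∀ k ≤ r + 1, ∃ s : Finset (Fin (r + 1)), s.card = k ∧
      ((r + 2).descFactorial k : ℂ) * alternatingTerm R (fun x => morrisDensity x * 1) =
        ((2 * r + 2).descFactorial k : ℂ) *
          alternatingTerm R (fun x => morrisDensity x * ∏ i ∈ s, x i) := by
    intro k
    induction k with
    | zero => exact fun _ => ⟨∅, by simp⟩
    | succ k ih =>
      intro hk
      obtain ⟨s, hs, ih⟩ := ih (by omega)
      obtain ⟨t, ht, htk⟩ := Finset.exists_subset_card_eq
        (s := (Finset.univ : Finset (Fin (r + 1))).erase 0) (n := k) (by simp; omega)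
      have h0 : (0 : Fin (r + 1)) ∉ t := fun h => (Finset.notMem_erase 0 _) (ht h)
      refine ⟨insert 0 t, by rw [Finset.card_insert_of_notMem h0, htk], ?_⟩
      have hrec := alternatingTerm_insert hR h0
      rw [alternatingTerm_prod_eq_of_card_eq (htk.trans hs.symm), htk] at hrec
      rw [Nat.descFactorial_succ, Nat.descFactorial_succ, Nat.cast_mul, Nat.cast_mul,
        Nat.cast_sub (by omega), Nat.cast_sub (by omega)]
      push_cast
      linear_combination ((r : ℂ) + 2 - k) * ih + ((2 * r + 2).descFactorial k : ℂ) * hrec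
  obtain ⟨s, hs, h⟩ := key (r + 1) le_rfl
  have hs' : s = Finset.univ := Finset.eq_univ_of_card s (by simpa using hs)
  subst hs'
  rw [alternatingTerm_of_symmetric (fun _ => 1) (fun _ _ => rfl),
    alternatingTerm_of_symmetric (fun x => ∏ i, x i) (fun x σ => Equiv.prod_comp σ x),
    constantTerm_congr hR (fun x hx => morrisDensity_mul_prod hx)] at h
  simp only [mul_one] at h
  -- The quotient of the two falling factorials of length `r + 1` is `catalan (r + 1)`.
  have h1 : (r + 2).descFactorial (r + 1) = (r + 2) * (r + 1).factorial := by
    have := Nat.factorial_mul_descFactorial (show r + 1 ≤ r + 2 by omega)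
    rw [Nat.factorial_succ (r + 1)] at this
    simpa using this
  have h2 : (2 * r + 2).descFactorial (r + 1) =
      (r + 1).factorial * ((r + 2) * catalan (r + 1)) := by
    rw [Nat.descFactorial_eq_factorial_mul_choose, succ_mul_catalan_eq_centralBinom,
      Nat.centralBinom]
    rfl
  rw [h1, h2] at h
  have hf : ((r + 1).factorial : ℂ) ≠ 0 := Nat.cast_ne_zero.2 (Nat.factorial_ne_zero _)
  have hr : ((r + 2 : ℕ) : ℂ) ≠ 0 := Nat.cast_ne_zero.2 (by omega)
  push_cast at h hr ⊢
  refine mul_left_cancel₀ (mul_ne_zero (mul_ne_zero hr hf) hf) ?_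
  linear_combination h

lemma flowDensity_snoc {r : ℕ} (y : Fin r → ℂ) (z : ℂ) :
    flowDensity (Fin.snoc y z : Fin (r + 1) → ℂ) =
      flowDensity y * ((1 - z)⁻¹ * ∏ j, (y j - z)⁻¹) := by
  rw [flowDensity, flowDensity, vandermondeInv_snoc, Fin.prod_univ_castSucc]
  simp only [Fin.snoc_castSucc, Fin.snoc_last]
  ring

/-- Taking the constant term in the smallest variable. -/
lemma constantTerm_flowDensity_succ {r : ℕ} {R : Fin (r + 1) → ℝ} (hR : IsRadii R)
    (hanti : StrictAnti R) :
    constantTerm R flowDensity = constantTerm (R ∘ Fin.castSucc) morrisDensity := by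
  have hR' : IsRadii (R ∘ Fin.castSucc) := hR.comp (Fin.castSucc_injective r)
  rw [constantTerm_succAbove R (Fin.last r) _ (hR.continuous (continuousOn_flowDensity _)),
    constantTerm]
  refine integral_congr_ae (Filter.Eventually.of_forall fun θ' => ?_)
  have hsucc : R ∘ (Fin.last r).succAbove = R ∘ Fin.castSucc := by
    ext i
    simp
  dsimp only
  rw [hsucc]
  set y := torusPoint (R ∘ Fin.castSucc) θ' with hy
  have hyn : ∀ j, ‖y j‖ = R j.castSucc := fun j => by
    rw [hy, torusPoint, norm_circlePoint, Function.comp_apply, abs_of_pos (hR.2 _).1]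
  have hins : ∀ z : ℂ, ((Fin.last r).insertNth z y : Fin (r + 1) → ℂ) = Fin.snoc y z := fun z => by
    simp
  simp_rw [hins, flowDensity_snoc, integral_const_mul]
  have hpos := (hR.2 (Fin.last r)).1
  -- All poles in the smallest variable, `1` and the `y j`, lie outside its disc. The average is the
  -- value at `0`, namely `∏ (y j)⁻¹`, which is what separates the two densities.
  have hz1 : ∀ z ∈ Metric.closedBall (0 : ℂ) (R (Fin.last r)), 1 - z ≠ 0 := fun z hz h => by
    rw [mem_closedBall_zero_iff, ← sub_eq_zero.1 h, norm_one] at hz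
    exact absurd (hR.2 (Fin.last r)).2 (not_lt.2 hz)
  have hz2 : ∀ z ∈ Metric.closedBall (0 : ℂ) (R (Fin.last r)), ∀ j, y j - z ≠ 0 :=
    fun z hz j h => by
      rw [mem_closedBall_zero_iff, ← sub_eq_zero.1 h, hyn] at hz
      exact absurd (hanti (Fin.castSucc_lt_last j)) (not_lt.2 hz)
  have hd : DifferentiableOn ℂ (fun z => (1 - z)⁻¹ * ∏ j, (y j - z)⁻¹)
      (Metric.closedBall (0 : ℂ) (R (Fin.last r))) := by
    refine DifferentiableOn.mul (DifferentiableOn.inv (by fun_prop) hz1)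
      (DifferentiableOn.fun_finsetProd fun j _ => ?_)
    exact DifferentiableOn.inv (by fun_prop) fun z hz => hz2 z hz j
  have := integral_circlePoint_of_diffContOnCl hpos
    (DifferentiableOn.diffContOnCl (by rwa [closure_ball _ hpos.ne']))
  rw [this, ← morrisDensity_mul_prod (hR'.torusPoint_mem θ'), ← hy]
  have hy0 : ∏ j, y j ≠ 0 := Finset.prod_ne_zero_iff.2 fun j _ => ((hR'.torusPoint_mem θ').2 j).1
  simp only [sub_zero, inv_one, one_mul, Finset.prod_inv_distrib]
  field_simp

lemma constantTerm_flowDensity {r : ℕ} {R : Fin r → ℝ} (hR : IsRadii R) (hanti : StrictAnti R) :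
    constantTerm R flowDensity = ∏ i ∈ Finset.range r, (catalan i : ℂ) := by
  induction r with
  | zero => simp [constantTerm, flowDensity, vandermondeInv, measureReal_def, volume_pi]
  | succ r ih =>
    have hR' : IsRadii (R ∘ Fin.castSucc) := hR.comp (Fin.castSucc_injective r)
    rw [constantTerm_flowDensity_succ hR hanti, constantTerm_morrisDensity hR',
      ih hR' (hanti.comp_strictMono Fin.strictMono_castSucc), Finset.prod_range_succ, mul_comm]

/-! ### Exponential integrals over simplices. -/

lemma integrable_restrict_prod_of_continuous {X Y : Type*} [TopologicalSpace X]
    [MeasurableSpace X] [BorelSpace X] [TopologicalSpace Y] [MeasurableSpace Y] [BorelSpace Y]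
    [CompactSpace Y] [T2Space X] [T2Space Y] [SecondCountableTopologyEither X Y]
    {μ : Measure X} [SFinite μ] [IsFiniteMeasureOnCompacts μ] {ν : Measure Y} [SFinite ν]
    [IsFiniteMeasure ν]
    {K : Set X} (hK : IsCompact K) {f : X × Y → ℂ} (hf : Continuous f) :
    Integrable f ((μ.restrict K).prod ν) := by
  have : (μ.restrict K).prod ν = (μ.prod ν).restrict (K ×ˢ Set.univ) := by
    rw [← Measure.prod_restrict, Measure.restrict_univ]
  rw [this]
  exact hf.continuousOn.integrableOn_compact (hK.prod isCompact_univ)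

/-- The solid simplex of nonnegative vectors with coordinate sum at most `s`. -/
def solidSimplex (m : ℕ) (s : ℝ) : Set (Fin m → ℝ) := {t | (∀ i, 0 ≤ t i) ∧ ∑ i, t i ≤ s}

lemma isCompact_solidSimplex (m : ℕ) (s : ℝ) : IsCompact (solidSimplex m s) := by
  refine Metric.isCompact_of_isClosed_isBounded ?_ ?_
  · have : solidSimplex m s = (⋂ i, {t | 0 ≤ t i}) ∩ {t | ∑ i, t i ≤ s} := by
      ext t
      simp [solidSimplex]
    rw [this]
    refine IsClosed.inter (isClosed_iInter fun i => ?_) ?_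
    · exact isClosed_le continuous_const (continuous_apply i)
    · exact isClosed_le (f := fun t : Fin m → ℝ => ∑ i, t i) (by fun_prop) continuous_const
  · refine (Metric.isBounded_Icc (0 : Fin m → ℝ) (fun _ => s)).subset fun t ht =>
      ⟨ht.1, fun i => ?_⟩
    exact (Finset.single_le_sum (fun j _ => ht.1 j) (Finset.mem_univ i)).trans ht.2

lemma cons_mem_solidSimplex {m : ℕ} {s a : ℝ} {t : Fin m → ℝ} :
    (Fin.cons a t : Fin (m + 1) → ℝ) ∈ solidSimplex (m + 1) s ↔
      a ∈ Set.Icc 0 s ∧ t ∈ solidSimplex m (s - a) := by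
  simp only [solidSimplex, Set.mem_ofPred_eq, Fin.forall_fin_succ, Fin.cons_zero, Fin.cons_succ,
    Fin.sum_univ_succ, Set.mem_Icc]
  constructor
  · rintro ⟨⟨h0, h1⟩, h2⟩
    have : 0 ≤ ∑ i, t i := Finset.sum_nonneg fun i _ => h1 i
    exact ⟨⟨h0, by linarith⟩, h1, by linarith⟩
  · rintro ⟨⟨h0, h1⟩, h2, h3⟩
    exact ⟨⟨h0, h2⟩, by linarith⟩

lemma setIntegral_solidSimplex_succ {m : ℕ} (s : ℝ) {f : (Fin (m + 1) → ℝ) → ℂ}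
    (hf : Continuous f) :
    ∫ t in solidSimplex (m + 1) s, f t =
      ∫ a in Set.Icc 0 s, ∫ t in solidSimplex m (s - a), f (Fin.cons a t) := by
  have h := (volume_preserving_piFinSuccAbove (fun _ : Fin (m + 1) => ℝ) 0).symm
  have hmeas : ∀ m s, MeasurableSet (solidSimplex m s) := fun m s =>
    (isCompact_solidSimplex m s).isClosed.measurableSet
  have hi : Integrable ((solidSimplex (m + 1) s).indicator f) :=
    (hf.continuousOn.integrableOn_compact (isCompact_solidSimplex _ _)).integrable_indicator
      (hmeas _ _)
  rw [← integral_indicator (hmeas _ _), ← h.integral_comp (MeasurableEquiv.measurableEmbedding _)]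
  rw [← h.integrable_comp_emb (MeasurableEquiv.measurableEmbedding _)] at hi
  rw [Measure.volume_eq_prod] at hi ⊢
  refine (integral_prod _ hi).trans ?_
  rw [← integral_indicator measurableSet_Icc]
  refine integral_congr_ae (Filter.Eventually.of_forall fun a => ?_)
  have hcons : ∀ t : Fin m → ℝ,
      (MeasurableEquiv.piFinSuccAbove (fun _ : Fin (m + 1) => ℝ) 0).symm (a, t) =
        (Fin.cons a t : Fin (m + 1) → ℝ) := fun t => by
    simp [MeasurableEquiv.piFinSuccAbove]
    rfl
  simp only [Function.comp_apply, hcons]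
  by_cases ha : a ∈ Set.Icc 0 s
  · rw [Set.indicator_of_mem ha, ← integral_indicator (hmeas _ _)]
    refine integral_congr_ae (Filter.Eventually.of_forall fun t => ?_)
    by_cases ht : t ∈ solidSimplex m (s - a)
    · simp only
      rw [Set.indicator_of_mem ht, Set.indicator_of_mem (cons_mem_solidSimplex.2 ⟨ha, ht⟩)]
    · simp only
      rw [Set.indicator_of_notMem ht,
        Set.indicator_of_notMem fun h => ht (cons_mem_solidSimplex.1 h).2]
  · rw [Set.indicator_of_notMem ha]
    refine integral_eq_zero_of_ae (Filter.Eventually.of_forall fun t => ?_)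
    exact Set.indicator_of_notMem (fun h => ha (cons_mem_solidSimplex.1 h).1) _

lemma circlePoint_ne {ρ : ℝ} (hρ : 0 < ρ) {y : ℂ} (hy : ‖y‖ < ρ) (θ : UnitAddCircle) :
    circlePoint ρ θ ≠ y := by
  rintro rfl
  rw [norm_circlePoint, abs_of_pos hρ] at hy
  exact hy.false

lemma differentiableOn_prod_mul_inv {m : ℕ} {ρ : ℝ} (hρ : 0 < ρ) {y : Fin m → ℂ}
    (hy : ∀ j, ‖y j‖ < ρ) :
    DifferentiableOn ℂ (fun w : ℂ => ∏ j, (w * (1 - w * y j)⁻¹)) (Metric.closedBall 0 ρ⁻¹) := by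
  refine DifferentiableOn.fun_finsetProd fun j _ => DifferentiableOn.mul (by fun_prop)
    (DifferentiableOn.inv (by fun_prop) fun w hw h => ?_)
  rw [mem_closedBall_zero_iff] at hw
  have h1 : ‖w * y j‖ = 1 := by rw [← sub_eq_zero.1 h, norm_one]
  rw [norm_mul] at h1
  have : ‖w‖ * ‖y j‖ < 1 := by
    calc ‖w‖ * ‖y j‖ ≤ ρ⁻¹ * ‖y j‖ := by gcongr
      _ < ρ⁻¹ * ρ := by gcongr; exact hy j
      _ = 1 := inv_mul_cancel₀ hρ.ne'
  exact this.ne h1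

lemma prod_inv_sub_inv {m : ℕ} {w : ℂ} (hw : w ≠ 0) (y : Fin m → ℂ) :
    ∏ j, (w⁻¹ - y j)⁻¹ = ∏ j, (w * (1 - w * y j)⁻¹) :=
  Finset.prod_congr rfl fun j _ => by
    rw [show w⁻¹ - y j = w⁻¹ * (1 - w * y j) by field_simp, mul_inv, inv_inv]

/-- All poles are inside the circle and there is at least one factor, so in `w = 1/z` the integrand
is holomorphic and vanishes at `w = 0`. -/
lemma integral_prod_circlePoint_sub_inv {m : ℕ} {ρ : ℝ} (hρ : 0 < ρ) {y : Fin (m + 1) → ℂ}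
    (hy : ∀ j, ‖y j‖ < ρ) :
    ∫ θ : UnitAddCircle, ∏ j, (circlePoint ρ θ - y j)⁻¹ = 0 := by
  have hρ' : 0 < ρ⁻¹ := inv_pos.2 hρ
  rw [integral_circlePoint_inv ρ (fun z => ∏ j, (z - y j)⁻¹)]
  have : ∀ θ, ∏ j, ((circlePoint ρ⁻¹ θ)⁻¹ - y j)⁻¹ =
      ∏ j, (circlePoint ρ⁻¹ θ * (1 - circlePoint ρ⁻¹ θ * y j)⁻¹) := fun θ =>
    prod_inv_sub_inv (circlePoint_ne hρ' (by simpa using hρ) θ) y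
  simp_rw [this]
  rw [integral_circlePoint_of_diffContOnCl (f := fun w => ∏ j, (w * (1 - w * y j)⁻¹)) hρ'
    (DifferentiableOn.diffContOnCl (by
      rw [closure_ball _ hρ'.ne']
      exact differentiableOn_prod_mul_inv hρ hy))]
  simp

/-- In `w = 1/z` the only pole inside the circle is `w = 1`, and the factor `(1 - z)⁻¹` becomes the
Cauchy kernel `w / (w - 1)`, which reproduces the value at `1`. -/
lemma integral_one_sub_inv_mul_prod {m : ℕ} {ρ : ℝ} (hρ : 0 < ρ) (hρ1 : ρ < 1) {y : Fin m → ℂ}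
    (hy : ∀ j, ‖y j‖ < ρ) :
    ∫ θ : UnitAddCircle, (1 - circlePoint ρ θ)⁻¹ * ∏ j, (circlePoint ρ θ - y j)⁻¹ =
      ∏ j, (1 - y j)⁻¹ := by
  have hρ' : 0 < ρ⁻¹ := inv_pos.2 hρ
  rw [integral_circlePoint_inv ρ (fun z => (1 - z)⁻¹ * ∏ j, (z - y j)⁻¹)]
  have : ∀ θ, (1 - (circlePoint ρ⁻¹ θ)⁻¹)⁻¹ * ∏ j, ((circlePoint ρ⁻¹ θ)⁻¹ - y j)⁻¹ =
      ((circlePoint ρ⁻¹ θ - 0) / (circlePoint ρ⁻¹ θ - 1)) •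
        ∏ j, (circlePoint ρ⁻¹ θ * (1 - circlePoint ρ⁻¹ θ * y j)⁻¹) := fun θ => by
    have hw : circlePoint ρ⁻¹ θ ≠ 0 := circlePoint_ne hρ' (by simpa using hρ) θ
    have hw1 : circlePoint ρ⁻¹ θ ≠ 1 :=
      circlePoint_ne hρ' (by simpa using (one_lt_inv₀ hρ).2 hρ1) θ
    rw [prod_inv_sub_inv hw, smul_eq_mul]
    congr 1
    generalize circlePoint ρ⁻¹ θ = w at hw hw1 ⊢
    have := sub_ne_zero.2 hw1
    field_simp
    ring
  simp_rw [this]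
  rw [integral_circlePoint _ (fun w => ((w - 0) / (w - 1)) • ∏ j, (w * (1 - w * y j)⁻¹)),
    DiffContOnCl.circleAverage_smul_div (f := fun w => ∏ j, (w * (1 - w * y j)⁻¹))]
  · simp
  · rw [abs_of_pos hρ']
    refine DifferentiableOn.diffContOnCl ?_
    rw [closure_ball _ hρ'.ne']
    exact differentiableOn_prod_mul_inv hρ hy
  · rw [abs_of_pos hρ', mem_ball_zero_iff, norm_one]
    exact (one_lt_inv₀ hρ).2 hρ1

lemma continuous_prod_circlePoint_sub_inv {m : ℕ} {ρ : ℝ} (hρ : 0 < ρ) {y : Fin m → ℂ}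
    (hy : ∀ j, ‖y j‖ < ρ) : Continuous fun θ => ∏ j, (circlePoint ρ θ - y j)⁻¹ := by
  have := continuous_circlePoint ρ
  exact continuous_finsetProd _ fun j _ => Continuous.inv₀ (by fun_prop) fun θ =>
    sub_ne_zero.2 (circlePoint_ne hρ (hy j) θ)

lemma integral_exp_segment {s : ℝ} (hs : 0 ≤ s) {y z : ℂ} (h : z ≠ y) :
    ∫ a in Set.Icc 0 s, Complex.exp (a * y) * Complex.exp ((s - a : ℝ) * z) =
      (Complex.exp (s * z) - Complex.exp (s * y)) * (z - y)⁻¹ := by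
  have h' : y - z ≠ 0 := sub_ne_zero.2 h.symm
  have h'' : z - y ≠ 0 := sub_ne_zero.2 h
  rw [integral_Icc_eq_integral_Ioc, ← intervalIntegral.integral_of_le hs]
  have : ∀ a : ℝ, Complex.exp (a * y) * Complex.exp ((s - a : ℝ) * z) =
      Complex.exp (s * z) * Complex.exp ((y - z) * a) := fun a => by
    rw [← Complex.exp_add, ← Complex.exp_add]
    push_cast
    ring_nf
  simp_rw [this]
  rw [intervalIntegral.integral_const_mul, integral_exp_mul_complex h']
  have h3 : Complex.exp (s * y) = Complex.exp (s * z) * Complex.exp ((y - z) * s) := by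
    rw [← Complex.exp_add]
    ring_nf
  rw [h3]
  simp only [Complex.ofReal_zero, mul_zero, Complex.exp_zero]
  field_simp
  ring

/-- The Hermite–Genocchi formula for the exponential function as a contour integral. -/
lemma setIntegral_solidSimplex_exp {m : ℕ} {ρ : ℝ} (hρ : 0 < ρ) {y : Fin m → ℂ}
    (hy : ∀ j, ‖y j‖ < ρ) {s : ℝ} (hs : 0 ≤ s) :
    ∫ t in solidSimplex m s, Complex.exp (∑ j, t j * y j) =
      ∫ θ : UnitAddCircle, Complex.exp (s * circlePoint ρ θ) *
        ∏ j, (circlePoint ρ θ - y j)⁻¹ := by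
  induction m generalizing s with
  | zero =>
    have : solidSimplex 0 s = Set.univ := by
      ext t
      simp [solidSimplex, hs]
    rw [this]
    simp only [Finset.univ_eq_empty, Finset.sum_empty, Finset.prod_empty, mul_one]
    rw [integral_circlePoint_of_diffContOnCl (f := fun z => Complex.exp (s * z)) hρ
      (Differentiable.diffContOnCl (by fun_prop))]
    simp [measureReal_def, volume_pi]
  | succ m ih =>
    have hc := continuous_circlePoint ρ
    have hcp := continuous_prod_circlePoint_sub_inv hρ (y := fun j => y (Fin.succ j))
      fun j => hy j.succ
    have hcp' := continuous_prod_circlePoint_sub_inv hρ hy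
    rw [setIntegral_solidSimplex_succ s (by fun_prop)]
    calc ∫ a in Set.Icc 0 s, ∫ t in solidSimplex m (s - a),
          Complex.exp (∑ j, ((Fin.cons a t : Fin (m + 1) → ℝ) j : ℂ) * y j)
        = ∫ a in Set.Icc 0 s, ∫ θ : UnitAddCircle, Complex.exp (a * y 0) *
            (Complex.exp ((s - a : ℝ) * circlePoint ρ θ) *
              ∏ j : Fin m, (circlePoint ρ θ - y j.succ)⁻¹) := by
          refine setIntegral_congr_fun measurableSet_Icc fun a ha => ?_
          simp only [Fin.sum_univ_succ, Fin.cons_zero, Fin.cons_succ, Complex.exp_add]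
          rw [integral_const_mul, integral_const_mul, ih (fun j => hy j.succ) (by linarith [ha.2])]
      _ = ∫ θ : UnitAddCircle, ∫ a in Set.Icc 0 s, Complex.exp (a * y 0) *
            (Complex.exp ((s - a : ℝ) * circlePoint ρ θ) *
              ∏ j : Fin m, (circlePoint ρ θ - y j.succ)⁻¹) := by
          refine integral_integral_swap ?_
          refine integrable_restrict_prod_of_continuous isCompact_Icc ?_
          exact Continuous.mul (by fun_prop)
            (Continuous.mul (by fun_prop) (hcp.comp continuous_snd))
      -- The integral over `a` is a divided difference of exponentials. Its second term, constant in
      -- the circle variable up to the rational product, integrates to zero.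
      _ = ∫ θ : UnitAddCircle, (Complex.exp (s * circlePoint ρ θ) *
            ∏ j, (circlePoint ρ θ - y j)⁻¹ -
              Complex.exp (s * y 0) * ∏ j, (circlePoint ρ θ - y j)⁻¹) := by
          refine integral_congr_ae (Filter.Eventually.of_forall fun θ => ?_)
          simp only [← mul_assoc]
          rw [integral_mul_const, integral_exp_segment hs (circlePoint_ne hρ (hy 0) θ),
            Fin.prod_univ_succ]
          ring
      _ = _ := by
          rw [integral_sub, integral_const_mul, integral_prod_circlePoint_sub_inv hρ hy, mul_zero,
            sub_zero]
          · exact Continuous.integrable_of_hasCompactSupport (by fun_prop)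
              (HasCompactSupport.of_compactSpace _)
          · exact Continuous.integrable_of_hasCompactSupport (by fun_prop)
              (HasCompactSupport.of_compactSpace _)

/-! ### Volumes of sets of flows. -/

/-- The edges `i < j` of the complete graph on `m` ordered vertices. -/
abbrev Edge (m : ℕ) : Type := {q : Fin m × Fin m // q.1 < q.2}

/-- The total flow out of the vertex `i`. -/
def outflow {m : ℕ} (u : Edge m → ℝ) (i : Fin m) : ℝ := ∑ e : Edge m, if e.1.1 = i then u e else 0

/-- The total flow into the vertex `i` from the other vertices. -/
def inflow {m : ℕ} (u : Edge m → ℝ) (i : Fin m) : ℝ := ∑ e : Edge m, if e.1.2 = i then u e else 0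

lemma continuous_outflow {m : ℕ} (i : Fin m) : Continuous fun u : Edge m → ℝ => outflow u i :=
  continuous_finsetSum _ fun e _ => by split_ifs <;> fun_prop

lemma continuous_inflow {m : ℕ} (i : Fin m) : Continuous fun u : Edge m → ℝ => inflow u i :=
  continuous_finsetSum _ fun e _ => by split_ifs <;> fun_prop

lemma outflow_smul {m : ℕ} (c : ℝ) (u : Edge m → ℝ) (i : Fin m) :
    outflow (c • u) i = c * outflow u i := by
  simp [outflow, Finset.mul_sum]

lemma inflow_smul {m : ℕ} (c : ℝ) (u : Edge m → ℝ) (i : Fin m) :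
    inflow (c • u) i = c * inflow u i := by
  simp [inflow, Finset.mul_sum]

/-- Nonnegative flows with external supply `x i` at the vertex `i`, where the flow may leave the
graph at every vertex. -/
def flowSet {m : ℕ} (x : Fin m → ℝ) : Set (Edge m → ℝ) :=
  {u | (∀ e, 0 ≤ u e) ∧ ∀ i, outflow u i ≤ x i + inflow u i}

lemma isClosed_flowSet {m : ℕ} :
    IsClosed {p : (Fin m → ℝ) × (Edge m → ℝ) | p.2 ∈ flowSet p.1} := by
  have : {p : (Fin m → ℝ) × (Edge m → ℝ) | p.2 ∈ flowSet p.1} =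
      (⋂ e, {p | 0 ≤ p.2 e}) ∩ ⋂ i, {p | outflow p.2 i ≤ p.1 i + inflow p.2 i} := by
    ext p
    simp [flowSet]
  rw [this]
  have h1 := fun i : Fin m => continuous_outflow i
  have h2 := fun i : Fin m => continuous_inflow i
  refine IsClosed.inter (isClosed_iInter fun e => ?_) (isClosed_iInter fun i => ?_)
  · exact isClosed_le continuous_const (by fun_prop)
  · exact isClosed_le ((h1 i).comp continuous_snd)
      (((continuous_apply i).comp continuous_fst).add ((h2 i).comp continuous_snd))

/-- The edges of the complete graph on `m + 1` vertices: those at the first vertex, and the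
others. -/
def edgeSuccEquiv (m : ℕ) : Fin m ⊕ Edge m ≃ Edge (m + 1) :=
  Equiv.ofBijective
    (Sum.elim (fun j => ⟨(0, j.succ), Fin.succ_pos j⟩)
      fun e => ⟨(e.1.1.succ, e.1.2.succ), Fin.succ_lt_succ_iff.2 e.2⟩) (by
    constructor
    · rintro (i | ⟨⟨a, b⟩, h⟩) (j | ⟨⟨c, d⟩, h'⟩) hij <;> simp_all
      exact absurd hij.1 (Fin.succ_ne_zero _).symm
    · rintro ⟨⟨a, b⟩, h⟩
      obtain ⟨b, rfl⟩ := Fin.exists_succ_eq.2 (Fin.ne_zero_of_lt h)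
      rcases Fin.eq_zero_or_eq_succ a with rfl | ⟨a, rfl⟩
      · exact ⟨Sum.inl b, rfl⟩
      · exact ⟨Sum.inr ⟨(a, b), Fin.succ_lt_succ_iff.1 h⟩, rfl⟩)

@[simp] lemma edgeSuccEquiv_inl {m : ℕ} (j : Fin m) :
    edgeSuccEquiv m (Sum.inl j) = ⟨(0, j.succ), Fin.succ_pos j⟩ := rfl

@[simp] lemma edgeSuccEquiv_inr {m : ℕ} (e : Edge m) : edgeSuccEquiv m (Sum.inr e) =
    ⟨(e.1.1.succ, e.1.2.succ), Fin.succ_lt_succ_iff.2 e.2⟩ := rfl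

/-- Splitting of a function on a type equivalent to a sum type. -/
def piSplit {α β γ : Type*} (e : α ⊕ β ≃ γ) : (γ → ℝ) ≃ᵐ (α → ℝ) × (β → ℝ) :=
  (MeasurableEquiv.piCongrLeft (fun _ : γ => ℝ) e).symm.trans
    (MeasurableEquiv.sumPiEquivProdPi fun _ => ℝ)

lemma piSplit_apply {α β γ : Type*} (e : α ⊕ β ≃ γ) (u : γ → ℝ) :
    piSplit e u = (fun a => u (e (Sum.inl a)), fun b => u (e (Sum.inr b))) := rfl

lemma measurePreserving_piSplit {α β γ : Type*} [Fintype α] [Fintype β] [Fintype γ]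
    (e : α ⊕ β ≃ γ) : MeasurePreserving (piSplit e) :=
  (volume_measurePreserving_sumPiEquivProdPi fun _ => ℝ).comp
    (volume_measurePreserving_piCongrLeft (fun _ : γ => ℝ) e).symm

/-- Nothing flows into vertex `0`, so its constraint only confines its outgoing flows to a simplex
of size `x 0`. These flows then act as additional supply at the remaining vertices. -/
lemma mem_flowSet_succ {m : ℕ} (x : Fin (m + 1) → ℝ) (u : Edge (m + 1) → ℝ) :
    u ∈ flowSet x ↔ (piSplit (edgeSuccEquiv m) u).1 ∈ solidSimplex m (x 0) ∧
      (piSplit (edgeSuccEquiv m) u).2 ∈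
        flowSet (fun i => x i.succ + (piSplit (edgeSuccEquiv m) u).1 i) := by
  have hz : ∀ i : Fin m, (0 : Fin (m + 1)) ≠ i.succ := fun i => (Fin.succ_ne_zero i).symm
  have h1 : ∀ f : Edge (m + 1) → ℝ, ∑ e, f e = ∑ j, f (edgeSuccEquiv m (Sum.inl j)) +
      ∑ e, f (edgeSuccEquiv m (Sum.inr e)) := fun f => by
    rw [← Equiv.sum_comp (edgeSuccEquiv m), Fintype.sum_sum_type]
  have h2 : (∀ e, 0 ≤ u e) ↔ (∀ j, 0 ≤ u (edgeSuccEquiv m (Sum.inl j))) ∧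
      ∀ e, 0 ≤ u (edgeSuccEquiv m (Sum.inr e)) := by
    rw [← (edgeSuccEquiv m).forall_congr_right, Sum.forall]
  simp only [flowSet, solidSimplex, Set.mem_ofPred_eq, piSplit_apply, outflow, inflow, h1, h2,
    Fin.forall_fin_succ, edgeSuccEquiv_inl, edgeSuccEquiv_inr, Fin.succ_ne_zero, hz, if_false,
    if_true, Fin.succ_inj, Finset.sum_const_zero, add_zero, zero_add, Finset.sum_ite_eq',
    Finset.mem_univ, add_assoc]
  tauto

lemma volume_flowSet_succ {m : ℕ} (x : Fin (m + 1) → ℝ) :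
    volume (flowSet x) =
      ∫⁻ t in solidSimplex m (x 0), volume (flowSet fun i => x i.succ + t i) := by
  set A : Set ((Fin m → ℝ) × (Edge m → ℝ)) :=
    {p | p.1 ∈ solidSimplex m (x 0) ∧ p.2 ∈ flowSet (fun i => x i.succ + p.1 i)} with hA
  have hs : MeasurableSet (solidSimplex m (x 0)) :=
    (isCompact_solidSimplex m _).isClosed.measurableSet
  have hmA : MeasurableSet A := by
    refine (measurable_fst hs).inter ?_
    exact (isClosed_flowSet.preimage (f := fun p : (Fin m → ℝ) × (Edge m → ℝ) =>
      ((fun i => x i.succ + p.1 i, p.2) : (Fin m → ℝ) × (Edge m → ℝ)))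
        (by fun_prop)).measurableSet
  have h1 : flowSet x = piSplit (edgeSuccEquiv m) ⁻¹' A := by
    ext u
    exact mem_flowSet_succ x u
  rw [h1, (measurePreserving_piSplit _).measure_preimage hmA.nullMeasurableSet,
    Measure.volume_eq_prod, Measure.prod_apply hmA, ← lintegral_indicator hs]
  refine lintegral_congr fun t => ?_
  by_cases ht : t ∈ solidSimplex m (x 0)
  · rw [Set.indicator_of_mem ht]
    congr 1
    ext v
    simp [hA, ht]
  · rw [Set.indicator_of_notMem ht]
    convert measure_empty (μ := (volume : Measure (Edge m → ℝ)))
    ext v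
    simp [hA, ht]

/-- The volume of the set of flows as a contour integral. -/
lemma volume_flowSet {m : ℕ} {R : Fin m → ℝ} (hR : IsRadii R) (hanti : StrictAnti R)
    {x : Fin m → ℝ} (hx : ∀ i, 0 ≤ x i) :
    ∃ v : ℝ, 0 ≤ v ∧ volume (flowSet x) = ENNReal.ofReal v ∧
      constantTerm R (fun y => Complex.exp (∑ i, x i * y i) * vandermondeInv y) = v := by
  induction m with
  | zero =>
    refine ⟨1, zero_le_one, ?_, ?_⟩
    · have : flowSet x = Set.univ := by
        ext u
        simp [flowSet]
      rw [this]
      simp [volume_pi]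
    · simp [constantTerm, vandermondeInv, measureReal_def, volume_pi]
  | succ m ih =>
    have hR' : IsRadii (R ∘ Fin.succ) := hR.comp (Fin.succ_injective m)
    have hanti' : StrictAnti (R ∘ Fin.succ) := hanti.comp_strictMono Fin.strictMono_succ
    set h : (Fin m → ℝ) → ℂ := fun t => constantTerm (R ∘ Fin.succ) fun y =>
      Complex.exp (∑ i, ((x i.succ + t i : ℝ) : ℂ) * y i) * vandermondeInv y
    have hs : MeasurableSet (solidSimplex m (x 0)) :=
      (isCompact_solidSimplex m _).isClosed.measurableSet
    -- The contour integral is a priori complex; the induction hypothesis makes it real and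
    -- nonnegative, as needed to compare the Lebesgue and Bochner integrals over `t`.
    have key : ∀ t ∈ solidSimplex m (x 0), 0 ≤ (h t).re ∧ h t = (h t).re ∧
        volume (flowSet fun i => x i.succ + t i) = ENNReal.ofReal (h t).re := fun t ht => by
      obtain ⟨v, hv0, hv1, hv2⟩ := ih hR' hanti' (x := fun i => x i.succ + t i)
        fun i => add_nonneg (hx _) (ht.1 i)
      have : h t = v := hv2
      rw [this, Complex.ofReal_re]
      exact ⟨hv0, rfl, hv1⟩
    have hcont : Continuous fun θ => vandermondeInv (torusPoint (R ∘ Fin.succ) θ) :=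
      hR'.continuous ((continuousOn_vandermondeInv m).mono fun x hx => hx.1)
    have hpt := continuous_torusPoint (R ∘ Fin.succ)
    have hintegrable : Integrable (fun p : (Fin m → ℝ) × (Fin m → UnitAddCircle) =>
        Complex.exp (∑ i, ((x i.succ + p.1 i : ℝ) : ℂ) * torusPoint (R ∘ Fin.succ) p.2 i) *
          vandermondeInv (torusPoint (R ∘ Fin.succ) p.2))
        ((volume.restrict (solidSimplex m (x 0))).prod volume) := by
      refine integrable_restrict_prod_of_continuous (isCompact_solidSimplex m _) ?_
      exact Continuous.mul (by fun_prop) (hcont.comp continuous_snd)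
    have hintegrable' : Integrable h (volume.restrict (solidSimplex m (x 0))) :=
      hintegrable.integral_prod_left
    have hre : Integrable (fun t => (h t).re) (volume.restrict (solidSimplex m (x 0))) :=
      hintegrable'.re
    refine ⟨∫ t in solidSimplex m (x 0), (h t).re, ?_, ?_, ?_⟩
    · exact setIntegral_nonneg hs fun t ht => (key t ht).1
    · rw [volume_flowSet_succ, ofReal_integral_eq_lintegral_ofReal hre]
      · exact setLIntegral_congr_fun hs fun t ht => (key t ht).2.2
      · exact (ae_restrict_iff' hs).2 (Filter.Eventually.of_forall fun t ht => (key t ht).1)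
    · rw [← integral_complex_ofReal, constantTerm_succAbove R 0]
      · calc _ = ∫ θ' : Fin m → UnitAddCircle, ∫ t in solidSimplex m (x 0),
              Complex.exp (∑ i, ((x i.succ + t i : ℝ) : ℂ) * torusPoint (R ∘ Fin.succ) θ' i) *
                vandermondeInv (torusPoint (R ∘ Fin.succ) θ') := by
              refine integral_congr_ae (Filter.Eventually.of_forall fun θ' => ?_)
              have hsucc : R ∘ Fin.succAbove 0 = R ∘ Fin.succ := by
                ext i
                simp
              dsimp only
              rw [hsucc]
              set y := torusPoint (R ∘ Fin.succ) θ' with hy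
              -- The first radius is the largest, so the circle for vertex `0` encloses all the `y
              -- j`, as Hermite–Genocchi requires.
              have hyn : ∀ j, ‖y j‖ < R 0 := fun j => by
                rw [hy, torusPoint, norm_circlePoint, Function.comp_apply, abs_of_pos (hR.2 _).1]
                exact hanti (Fin.succ_pos j)
              have hins : ∀ z : ℂ, ((0 : Fin (m + 1)).insertNth z y : Fin (m + 1) → ℂ) =
                  Fin.cons z y := fun z => by simp
              simp only [hins, Fin.sum_univ_succ, Fin.cons_zero, Fin.cons_succ,
                vandermondeInv_cons, Complex.ofReal_add, add_mul, Finset.sum_add_distrib,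
                Complex.exp_add]
              rw [integral_mul_const, integral_const_mul,
                setIntegral_solidSimplex_exp (hR.2 0).1 hyn (hx 0), mul_assoc, mul_comm,
                mul_assoc, ← integral_mul_const]
              refine integral_congr_ae (Filter.Eventually.of_forall fun θ => ?_)
              ring
          _ = ∫ t in solidSimplex m (x 0), h t := (integral_integral_swap hintegrable).symm
          _ = _ := setIntegral_congr_fun hs fun t ht => (key t ht).2.1
      · refine hR.continuous (ContinuousOn.mul
          (f := fun y : Fin (m + 1) → ℂ => Complex.exp (∑ i, x i * y i)) (by fun_prop)
          ((continuousOn_vandermondeInv _).mono fun x hx => hx.1))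

open Pointwise in
lemma flowSet_smul {m : ℕ} {c : ℝ} (hc : 0 < c) (x : Fin m → ℝ) :
    flowSet (c • x) = c • flowSet x := by
  ext u
  rw [Set.mem_smul_set_iff_inv_smul_mem₀ hc.ne']
  have hc' : 0 < c⁻¹ := inv_pos.2 hc
  refine and_congr (forall_congr' fun e => ?_) (forall_congr' fun i => ?_)
  · simp [hc']
  · rw [outflow_smul, inflow_smul, Pi.smul_apply, smul_eq_mul, ← mul_le_mul_iff_right₀ hc', mul_add,
      inv_mul_cancel_left₀ hc.ne']

/-- Averaging over the outermost variable `y₀` amounts to evaluating the remaining rational factors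
at the pole `y₀ = 1`. -/
lemma constantTerm_div_one_sub {m : ℕ} {R : Fin (m + 1) → ℝ} (hR : IsRadii R)
    (hanti : StrictAnti R) :
    constantTerm R (fun y => vandermondeInv y * (1 - y 0)⁻¹) =
      constantTerm (R ∘ Fin.succ) flowDensity := by
  rw [constantTerm_succAbove R 0, constantTerm]
  · refine integral_congr_ae (Filter.Eventually.of_forall fun θ' => ?_)
    have hsucc : R ∘ Fin.succAbove 0 = R ∘ Fin.succ := by
      ext i
      simp
    dsimp only
    rw [hsucc]
    set y := torusPoint (R ∘ Fin.succ) θ' with hy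
    have hyn : ∀ j, ‖y j‖ < R 0 := fun j => by
      rw [hy, torusPoint, norm_circlePoint, Function.comp_apply, abs_of_pos (hR.2 _).1]
      exact hanti (Fin.succ_pos j)
    have hins : ∀ z : ℂ, ((0 : Fin (m + 1)).insertNth z y : Fin (m + 1) → ℂ) =
        Fin.cons z y := fun z => by simp
    simp only [hins, vandermondeInv_cons, Fin.cons_zero]
    rw [flowDensity, ← integral_one_sub_inv_mul_prod (hR.2 0).1 (hR.2 0).2 hyn,
      ← integral_mul_const]
    refine integral_congr_ae (Filter.Eventually.of_forall fun θ => ?_)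
    ring
  · refine hR.continuous (((continuousOn_vandermondeInv _).mono fun x hx => hx.1).fun_mul
      (g := fun y => (1 - y 0)⁻¹) ?_)
    exact ContinuousOn.inv₀ (by fun_prop) fun x hx => sub_ne_zero.2 (hx.2 0).2.symm

/-- A Laplace transform taken under the integral sign: `∫ exp(-s) exp(s y₀) ds = (1 - y₀)⁻¹`,
convergent because `|y₀| = R 0 < 1`. -/
lemma integral_Ioi_constantTerm {m : ℕ} {R : Fin (m + 1) → ℝ} (hR : IsRadii R) :
    ∫ s in Set.Ioi (0 : ℝ), (Real.exp (-s) : ℂ) *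
      constantTerm R (fun y => Complex.exp (s * y 0) * vandermondeInv y) =
    constantTerm R (fun y => vandermondeInv y * (1 - y 0)⁻¹) := by
  have hpt := continuous_torusPoint R
  have hcont : Continuous fun θ => vandermondeInv (torusPoint R θ) :=
    hR.continuous ((continuousOn_vandermondeInv _).mono fun x hx => hx.1)
  have hn : ∀ θ, ‖torusPoint R θ 0‖ = R 0 := fun θ => by
    rw [torusPoint, norm_circlePoint, abs_of_pos (hR.2 _).1]
  have hR1 : 0 < 1 - R 0 := sub_pos.2 (hR.2 0).2
  simp only [constantTerm, ← integral_const_mul]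
  rw [integral_integral_swap]
  · refine integral_congr_ae (Filter.Eventually.of_forall fun θ => ?_)
    dsimp only
    set y := torusPoint R θ with hy
    have hre : (y 0 - 1).re < 0 := by
      have := Complex.re_le_norm (y 0)
      rw [hy, hn] at this
      simp only [Complex.sub_re, Complex.one_re]
      linarith
    have h1 : ∀ s : ℝ, (Real.exp (-s) : ℂ) * (Complex.exp (s * y 0) * vandermondeInv y) =
        vandermondeInv y * Complex.exp ((y 0 - 1) * s) := fun s => by
      rw [← mul_assoc, Complex.ofReal_exp, ← Complex.exp_add, mul_comm]
      push_cast
      ring_nf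
    simp_rw [h1]
    rw [integral_const_mul, integral_exp_mul_complex_Ioi hre]
    have h0 : y 0 - 1 ≠ 0 := fun h => by simp [h] at hre
    have h0' : 1 - y 0 ≠ 0 := fun h => h0 (by linear_combination -h)
    congr 1
    simp only [Complex.ofReal_zero, mul_zero, Complex.exp_zero]
    field_simp
    ring
  · have hb : Integrable (fun p : ℝ × (Fin (m + 1) → UnitAddCircle) =>
        Real.exp (-(1 - R 0) * p.1) * ‖vandermondeInv (torusPoint R p.2)‖)
        ((volume.restrict (Set.Ioi 0)).prod volume) :=
      Integrable.mul_prod (integrableOn_exp_mul_Ioi (by linarith) 0)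
        (hcont.norm.integrable_of_hasCompactSupport (HasCompactSupport.of_compactSpace _))
    refine hb.mono' ?_ ?_
    · refine Continuous.aestronglyMeasurable ?_
      exact Continuous.mul (by fun_prop) (Continuous.mul (by fun_prop) (hcont.comp continuous_snd))
    · have : ∀ᵐ p : ℝ × (Fin (m + 1) → UnitAddCircle)
          ∂((volume.restrict (Set.Ioi 0)).prod volume), p.1 ∈ Set.Ioi (0 : ℝ) :=
        Measure.quasiMeasurePreserving_fst.ae (ae_restrict_mem measurableSet_Ioi)
      filter_upwards [this] with p hp
      simp only [Function.uncurry]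
      rw [norm_mul, norm_mul, ← mul_assoc, Complex.norm_real, Real.norm_eq_abs, Real.abs_exp,
        Complex.norm_exp, ← Real.exp_add]
      refine mul_le_mul_of_nonneg_right (Real.exp_le_exp.2 ?_) (norm_nonneg _)
      have h1 := Complex.re_le_norm (torusPoint R p.2 0)
      rw [hn] at h1
      have h2 : ((p.1 : ℂ) * torusPoint R p.2 0).re = p.1 * (torusPoint R p.2 0).re := by simp
      rw [h2]
      have h3 : 0 < p.1 := hp
      nlinarith

/-- The volume of the set of unit flows from the first vertex. -/
theorem factorial_mul_volume_flowSet (m : ℕ) :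
    ((Fintype.card (Edge (m + 1))).factorial : ℝ) *
        volume.real (flowSet (Pi.single 0 1 : Fin (m + 1) → ℝ)) =
      ∏ i ∈ Finset.range m, (catalan i : ℝ) := by
  -- Any strictly decreasing radii in `(0, 1)` would do.
  set R : Fin (m + 1) → ℝ := fun i => ((i : ℝ) + 2)⁻¹
  have hanti : StrictAnti R := fun i j hij => by
    have : (i : ℝ) < j := by exact_mod_cast hij
    have h0 : (0 : ℝ) ≤ (i : ℝ) := Nat.cast_nonneg _
    exact inv_strictAnti₀ (by linarith) (by linarith)
  have hR : IsRadii R := ⟨hanti.injective, fun i => by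
    have h0 : (0 : ℝ) ≤ (i : ℝ) := Nat.cast_nonneg _
    exact ⟨by positivity, inv_lt_one_of_one_lt₀ (by linarith)⟩⟩
  set x : Fin (m + 1) → ℝ := Pi.single 0 1
  set d := Fintype.card (Edge (m + 1))
  -- The flows with supply `s` are the dilates by `s` of those with unit supply, so their volume is
  -- homogeneous of degree `d`.
  have hV : ∀ s ∈ Set.Ioi (0 : ℝ), ((s ^ d * volume.real (flowSet x) : ℝ) : ℂ) =
      constantTerm R (fun y => Complex.exp (s * y 0) * vandermondeInv y) := fun s hs => by
    obtain ⟨v, hv0, hv1, hv2⟩ := volume_flowSet hR hanti (x := s • x) fun i => by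
      refine mul_nonneg (le_of_lt hs) ?_
      by_cases hi : i = 0
      · subst hi; simp [x]
      · simp [x, hi]
    have h1 : ∀ y : Fin (m + 1) → ℂ, ∑ i, (((s • x) i : ℝ) : ℂ) * y i = s * y 0 := fun y => by
      simp [x, Fin.sum_univ_succ]
    simp only [h1] at hv2
    rw [hv2]
    rw [flowSet_smul hs, Measure.addHaar_smul, Module.finrank_fintype_fun_eq_card] at hv1
    have h2 := congrArg ENNReal.toReal hv1
    rw [ENNReal.toReal_mul, ENNReal.toReal_ofReal hv0, ENNReal.toReal_ofReal (abs_nonneg _),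
      abs_of_pos (pow_pos hs _)] at h2
    rw [← h2]
    rfl
  have h1 := integral_Ioi_constantTerm hR
  rw [constantTerm_div_one_sub hR hanti, constantTerm_flowDensity
    (hR.comp (Fin.succ_injective m)) (hanti.comp_strictMono Fin.strictMono_succ)] at h1
  have h2 : ∫ s in Set.Ioi (0 : ℝ), (Real.exp (-s) : ℂ) *
      constantTerm R (fun y => Complex.exp (s * y 0) * vandermondeInv y) =
      ((∫ s in Set.Ioi (0 : ℝ), Real.exp (-s) * (s ^ d * volume.real (flowSet x)) : ℝ) : ℂ) := by
    rw [← integral_complex_ofReal]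
    refine setIntegral_congr_fun measurableSet_Ioi fun s hs => ?_
    rw [← hV s hs, ← Complex.ofReal_mul]
  rw [h2] at h1
  have h3 : ∫ s in Set.Ioi (0 : ℝ), Real.exp (-s) * (s ^ d * volume.real (flowSet x)) =
      d.factorial * volume.real (flowSet x) := by
    simp only [← mul_assoc]
    rw [integral_mul_const, ← Real.Gamma_nat_eq_factorial, Real.Gamma_eq_integral (by positivity)]
    simp
  rw [h3] at h1
  exact_mod_cast h1

/-! ### Volumes normalized by lattices. -/

section lattice

variable {κ : Type*} [Fintype κ]

lemma eq_span_of_mem_iff {E : Type*} [AddCommGroup E] [Module ℝ E]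
    (φ : (κ → ℝ) ≃ₗ[ℝ] E) {L : Submodule ℤ E}
    (hL : ∀ v, φ v ∈ L ↔ v ∈ integralVectors κ) :
    L = Submodule.span ℤ (Set.range ((Pi.basisFun ℝ κ).map φ)) := by
  ext w
  obtain ⟨v, rfl⟩ := φ.surjective w
  rw [hL, Module.Basis.mem_span_iff_repr_mem]
  refine forall_congr' fun i => ?_
  simp [eq_comm]

/-- A linear isomorphism carrying the standard lattice to `L` carries Lebesgue measure to the
measure normalized by `L`. -/
lemma latticeMeasure_eq_map {E : Type*} [NormedAddCommGroup E] [NormedSpace ℝ E]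
    [FiniteDimensional ℝ E] [MeasurableSpace E] [BorelSpace E]
    (φ : (κ → ℝ) ≃ₗ[ℝ] E) {L : Submodule ℤ E}
    (hL : ∀ v, φ v ∈ L ↔ v ∈ integralVectors κ) :
    latticeMeasure L = (volume : Measure (κ → ℝ)).map φ := by
  set b := (Pi.basisFun ℝ κ).map φ with hb
  have hLb : L = Submodule.span ℤ (Set.range b) := eq_span_of_mem_iff φ hL
  have hcov : ZLattice.covolume L (Measure.addHaar : Measure E) =
      (Measure.addHaar : Measure E).real (ZSpan.fundamentalDomain b) := by
    subst hLb
    exact ZLattice.covolume_eq_measure_fundamentalDomain _ _ (ZSpan.isAddFundamentalDomain b _)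
  have hfin : (Measure.addHaar : Measure E) (ZSpan.fundamentalDomain b) ≠ ⊤ :=
    (ZSpan.fundamentalDomain_isBounded b).measure_lt_top.ne
  have hne : (Measure.addHaar : Measure E) (ZSpan.fundamentalDomain b) ≠ 0 :=
    ZSpan.measure_fundamentalDomain_ne_zero b
  have hφ : Measurable φ := φ.toContinuousLinearEquiv.continuous.measurable
  -- The fundamental domain pulls back to the unit cube. Two Haar measures are proportional, and
  -- this value fixes the factor.
  have hone : (volume : Measure (κ → ℝ)).map φ (ZSpan.fundamentalDomain b) = 1 := by
    rw [Measure.map_apply hφ (ZSpan.fundamentalDomain_measurableSet b)]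
    have : φ ⁻¹' ZSpan.fundamentalDomain b = Set.pi Set.univ fun _ : κ => Set.Ico (0 : ℝ) 1 := by
      ext v
      simp [ZSpan.mem_fundamentalDomain, hb]
    rw [this, volume_pi_pi]
    simp
  have hHaar : ((volume : Measure (κ → ℝ)).map φ).IsAddHaarMeasure :=
    φ.toContinuousLinearEquiv.isAddHaarMeasure_map volume
  have huniq := Measure.isAddLeftInvariant_eq_smul ((volume : Measure (κ → ℝ)).map φ)
    (Measure.addHaar : Measure E)
  rw [latticeMeasure, hcov, measureReal_def, ENNReal.ofReal_toReal hfin]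
  rw [huniq] at hone ⊢
  rw [Measure.smul_apply, ENNReal.smul_def, smul_eq_mul] at hone
  rw [← ENNReal.eq_inv_of_mul_eq_one_left hone]
  rfl

/-- The measure of a set that is parametrized by a subset `S` of `ℝ^κ`. -/
lemma map_real_translateTo {F : Type*} [NormedAddCommGroup F] [NormedSpace ℝ F]
    [MeasurableSpace F] [BorelSpace F]
    {W : Submodule ℝ F} [FiniteDimensional ℝ W] (φ : (κ → ℝ) ≃ₗ[ℝ] W) (p : F)
    {S : Set (κ → ℝ)} (hS : S.Nonempty) :
    ((volume : Measure (κ → ℝ)).map φ).real (translateTo W ((fun v => p + (φ v : F)) '' S)) =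
      volume.real S := by
  set P := (fun v => p + (φ v : F)) '' S
  have hP : P.Nonempty := hS.image _
  obtain ⟨v₀, -, hv₀⟩ := hP.some_mem
  -- The base point chosen in `translateTo` has some parameter `v₀`, so changing base point only
  -- translates `S`.
  have hpre : φ ⁻¹' translateTo W P = (v₀ + ·) ⁻¹' S := by
    ext v
    have h1 : hP.some + (φ v : F) = p + (φ (v₀ + v) : F) := by
      rw [← hv₀, map_add, Submodule.coe_add, add_assoc]
    simp only [Set.mem_preimage, translateTo, Set.mem_ofPred_eq]
    constructor
    · rintro ⟨h, w, hw, hw'⟩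
      dsimp only at hw'
      rw [h1, add_right_inj, Subtype.coe_inj, φ.injective.eq_iff] at hw'
      rwa [← hw']
    · exact fun h => ⟨hP, v₀ + v, h, h1.symm⟩
  have hmap : (volume : Measure (κ → ℝ)).map φ (translateTo W P) =
      volume (φ ⁻¹' translateTo W P) :=
    (φ.toContinuousLinearEquiv.toHomeomorph.toMeasurableEquiv).map_apply _
  rw [measureReal_def, hmap, hpre, measure_preimage_add, measureReal_def]

lemma affineSpan_eq_top_of_volume_ne_zero {S : Set (κ → ℝ)} (hS : volume S ≠ 0) :
    affineSpan ℝ S = ⊤ := by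
  by_contra h
  exact hS (measure_mono_null (subset_affineSpan ℝ S)
    (Measure.addHaar_affineSubspace volume _ h))

/-- The relative volume of a polytope with an integral parametrization. -/
lemma latticeRelVolume_image {ι : Type*} [Fintype ι] (f : (κ → ℝ) →ₗ[ℝ] (ι → ℝ))
    (hf : ∀ v, f v ∈ integralVectors ι ↔ v ∈ integralVectors κ) (hinj : Function.Injective f)
    (p : ι → ℝ) {S : Set (κ → ℝ)} (hS : volume S ≠ 0) :
    latticeRelVolume ((fun v => p + f v) '' S) =
      (Fintype.card κ).factorial * volume.real S := by
  have hdir : (affineSpan ℝ ((fun v => p + f v) '' S)).direction = LinearMap.range f := by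
    set A : (κ → ℝ) →ᵃ[ℝ] (ι → ℝ) := AffineMap.const ℝ _ p + f.toAffineMap
    have : (fun v => p + f v) = A := rfl
    rw [this, ← AffineSubspace.map_span, affineSpan_eq_top_of_volume_ne_zero hS,
      AffineSubspace.map_direction, AffineSubspace.direction_top, Submodule.map_top]
    simp [A]
  have hne : S.Nonempty := by
    by_contra h
    rw [Set.not_nonempty_iff_eq_empty] at h
    exact hS (by rw [h, measure_empty])
  -- The direction equals `LinearMap.range f` only propositionally; a variable `W` lets the types
  -- and measures depending on it be rewritten together.
  suffices h : ∀ (W : Submodule ℝ (ι → ℝ)) [FiniteDimensional ℝ W], W = LinearMap.range f →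
      ((Module.finrank ℝ W).factorial : ℝ) *
        (latticeMeasure (latticeIn W (integralVectors ι))).real
          (translateTo W ((fun v => p + f v) '' S)) =
      (Fintype.card κ).factorial * volume.real S from h _ hdir
  rintro W _ rfl
  set φ := LinearEquiv.ofInjective f hinj with hφ
  rw [latticeMeasure_eq_map φ (fun v => hf v), LinearMap.finrank_range_of_inj hinj,
    Module.finrank_fintype_fun_eq_card]
  congr 1
  exact map_real_translateTo φ p hne

end lattice

/-! ### Circulations and the quotient measure. -/

/-- The edges of the complete graph on `n + 1` vertices: those at the last vertex, and the
others. -/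
def edgeCastSuccEquiv (n : ℕ) : Fin n ⊕ Edge n ≃ Edge (n + 1) :=
  Equiv.ofBijective
    (Sum.elim (fun i => ⟨(i.castSucc, Fin.last n), Fin.castSucc_lt_last i⟩)
      fun e => ⟨(e.1.1.castSucc, e.1.2.castSucc), Fin.castSucc_lt_castSucc_iff.2 e.2⟩) (by
    constructor
    · rintro (i | ⟨⟨a, b⟩, h⟩) (j | ⟨⟨c, d⟩, h'⟩) hij <;> simp_all
      exact absurd hij.2.symm (Fin.castSucc_lt_last _).ne
    · rintro ⟨⟨a, b⟩, h⟩
      obtain ⟨a, rfl⟩ := Fin.exists_castSucc_eq.2 (Fin.ne_last_of_lt h)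
      rcases Fin.eq_castSucc_or_eq_last b with ⟨b, rfl⟩ | rfl
      · exact ⟨Sum.inr ⟨(a, b), Fin.castSucc_lt_castSucc_iff.1 h⟩, rfl⟩
      · exact ⟨Sum.inl a, rfl⟩)

@[simp] lemma edgeCastSuccEquiv_inl {n : ℕ} (i : Fin n) :
    edgeCastSuccEquiv n (Sum.inl i) = ⟨(i.castSucc, Fin.last n), Fin.castSucc_lt_last i⟩ := rfl

@[simp] lemma edgeCastSuccEquiv_inr {n : ℕ} (e : Edge n) : edgeCastSuccEquiv n (Sum.inr e) =
    ⟨(e.1.1.castSucc, e.1.2.castSucc), Fin.castSucc_lt_castSucc_iff.2 e.2⟩ := rfl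

/-- The flow with the values `c` on the edges into the last vertex and `v` on the others. -/
def joinFlow {n : ℕ} (c : Fin n → ℝ) (v : Edge n → ℝ) : Edge (n + 1) → ℝ :=
  fun e => Sum.elim c v ((edgeCastSuccEquiv n).symm e)

/-- The flow on the edges into the last vertex. -/
def sinkFlow {n : ℕ} (u : Edge (n + 1) → ℝ) (i : Fin n) : ℝ := u (edgeCastSuccEquiv n (Sum.inl i))

/-- The flow on the edges not meeting the last vertex. -/
def innerFlow {n : ℕ} (u : Edge (n + 1) → ℝ) (e : Edge n) : ℝ :=
  u (edgeCastSuccEquiv n (Sum.inr e))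

@[simp] lemma sinkFlow_joinFlow {n : ℕ} (c : Fin n → ℝ) (v : Edge n → ℝ) :
    sinkFlow (joinFlow c v) = c := by
  ext i
  simp only [sinkFlow, joinFlow, Equiv.symm_apply_apply, Sum.elim_inl]

@[simp] lemma innerFlow_joinFlow {n : ℕ} (c : Fin n → ℝ) (v : Edge n → ℝ) :
    innerFlow (joinFlow c v) = v := by
  ext i
  simp only [innerFlow, joinFlow, Equiv.symm_apply_apply, Sum.elim_inr]

@[simp] lemma joinFlow_sinkFlow_innerFlow {n : ℕ} (u : Edge (n + 1) → ℝ) :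
    joinFlow (sinkFlow u) (innerFlow u) = u := by
  ext e
  obtain ⟨x, rfl⟩ := (edgeCastSuccEquiv n).surjective e
  rcases x with i | e <;> simp only [joinFlow, Equiv.symm_apply_apply, Sum.elim_inl,
    Sum.elim_inr, sinkFlow, innerFlow]

lemma joinFlow_add {n : ℕ} (c c' : Fin n → ℝ) (v v' : Edge n → ℝ) :
    joinFlow (c + c') (v + v') = joinFlow c v + joinFlow c' v' := by
  ext e
  obtain ⟨x, rfl⟩ := (edgeCastSuccEquiv n).surjective e
  rcases x with i | e <;> simp only [joinFlow, Equiv.symm_apply_apply, Sum.elim_inl,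
    Sum.elim_inr, Pi.add_apply]

lemma joinFlow_smul {n : ℕ} (a : ℝ) (c : Fin n → ℝ) (v : Edge n → ℝ) :
    joinFlow (a • c) (a • v) = a • joinFlow c v := by
  ext e
  obtain ⟨x, rfl⟩ := (edgeCastSuccEquiv n).surjective e
  rcases x with i | e <;> simp only [joinFlow, Equiv.symm_apply_apply, Sum.elim_inl,
    Sum.elim_inr, Pi.smul_apply]

section sums

variable {n : ℕ} (u : Edge (n + 1) → ℝ)

lemma sum_edge_castSucc (f : Edge (n + 1) → ℝ) :
    ∑ e, f e = ∑ i, f (edgeCastSuccEquiv n (Sum.inl i)) +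
      ∑ e, f (edgeCastSuccEquiv n (Sum.inr e)) := by
  rw [← Equiv.sum_comp (edgeCastSuccEquiv n), Fintype.sum_sum_type]

lemma outflow_castSucc (i : Fin n) :
    outflow u i.castSucc = sinkFlow u i + outflow (innerFlow u) i := by
  simp [outflow, sum_edge_castSucc, sinkFlow, innerFlow]

lemma inflow_castSucc (i : Fin n) : inflow u i.castSucc = inflow (innerFlow u) i := by
  have : Fin.last n ≠ i.castSucc := (Fin.castSucc_lt_last i).ne'
  simp [inflow, sum_edge_castSucc, innerFlow, this]

lemma outflow_last : outflow u (Fin.last n) = 0 :=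
  Finset.sum_eq_zero fun e _ => if_neg (Fin.ne_last_of_lt e.2)

lemma inflow_zero : inflow u 0 = 0 :=
  Finset.sum_eq_zero fun e _ => if_neg (Fin.ne_zero_of_lt e.2)

end sums

lemma sum_outflow {n : ℕ} (u : Edge n → ℝ) : ∑ i, outflow u i = ∑ e, u e := by
  simp only [outflow]
  rw [Finset.sum_comm]
  simp

lemma sum_inflow {n : ℕ} (u : Edge n → ℝ) : ∑ i, inflow u i = ∑ e, u e := by
  simp only [inflow]
  rw [Finset.sum_comm]
  simp

lemma partitionMap_posRoots (n : ℕ) (u : Edge (n + 1) → ℝ) (k : Fin (n + 1)) :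
    partitionMap (posRoots n) u k = outflow u k - inflow u k := by
  simp [partitionMap, Fintype.linearCombination_apply, posRoots, outflow, inflow,
    ← Finset.sum_sub_distrib, mul_sub, Pi.single_apply, eq_comm]

lemma sum_partitionMap_posRoots (n : ℕ) (u : Edge (n + 1) → ℝ) :
    ∑ k, partitionMap (posRoots n) u k = 0 := by
  simp only [partitionMap_posRoots, Finset.sum_sub_distrib, sum_outflow, sum_inflow, sub_self]

lemma partitionMap_posRoots_last (n : ℕ) (u : Edge (n + 1) → ℝ) :
    partitionMap (posRoots n) u (Fin.last n) =
      -∑ i : Fin n, partitionMap (posRoots n) u i.castSucc := by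
  have := sum_partitionMap_posRoots n u
  rw [Fin.sum_univ_castSucc] at this
  linarith

/-- The excess of inflow over outflow at each vertex. -/
def excess {n : ℕ} (v : Edge n → ℝ) (i : Fin n) : ℝ := inflow v i - outflow v i

lemma excess_add {n : ℕ} (v w : Edge n → ℝ) : excess (v + w) = excess v + excess w := by
  ext i
  simp only [excess, inflow, outflow, ← Finset.sum_sub_distrib, Pi.add_apply,
    ← Finset.sum_add_distrib]
  refine Finset.sum_congr rfl fun e _ => ?_
  split_ifs <;> ring

lemma excess_smul {n : ℕ} (a : ℝ) (v : Edge n → ℝ) : excess (a • v) = a • excess v := by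
  ext i
  simp only [excess, inflow_smul, outflow_smul, Pi.smul_apply, smul_eq_mul]
  ring

lemma continuous_excess {n : ℕ} : Continuous (excess (n := n)) :=
  continuous_pi fun i => (continuous_inflow i).sub (continuous_outflow i)

lemma partitionMap_castSucc (n : ℕ) (u : Edge (n + 1) → ℝ) (i : Fin n) :
    partitionMap (posRoots n) u i.castSucc = sinkFlow u i - excess (innerFlow u) i := by
  rw [partitionMap_posRoots, outflow_castSucc, inflow_castSucc, excess]
  ring

/-- The coordinates of both sides sum to zero, so the equation at the sink is redundant. The others
determine the flow into the sink from the inner flow. -/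
lemma partitionMap_posRoots_eq_iff {n : ℕ} {u : Edge (n + 1) → ℝ} {a : Fin (n + 1) → ℝ}
    (ha : ∑ k, a k = 0) :
    partitionMap (posRoots n) u = a ↔
      ∀ i : Fin n, sinkFlow u i = a i.castSucc + excess (innerFlow u) i := by
  constructor
  · rintro rfl i
    rw [partitionMap_castSucc]
    ring
  · intro h
    have h1 : ∀ i : Fin n, partitionMap (posRoots n) u i.castSucc = a i.castSucc := fun i => by
      rw [partitionMap_castSucc, h]
      ring
    ext k
    refine Fin.lastCases ?_ h1 k
    rw [partitionMap_posRoots_last, Finset.sum_congr rfl fun i _ => h1 i]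
    rw [Fin.sum_univ_castSucc] at ha
    linarith

/-- The extension of a flow to a circulation through the last vertex. -/
def circulation (n : ℕ) : (Edge n → ℝ) →ₗ[ℝ] (Edge (n + 1) → ℝ) where
  toFun v := joinFlow (excess v) v
  map_add' v w := by rw [excess_add, joinFlow_add]
  map_smul' a v := by rw [excess_smul, joinFlow_smul, RingHom.id_apply]

lemma circulation_apply {n : ℕ} (v : Edge n → ℝ) : circulation n v = joinFlow (excess v) v := rfl

/-- Circulations are parametrized by their values away from the last vertex. -/
def kerEquiv (n : ℕ) : (Edge n → ℝ) ≃ₗ[ℝ] LinearMap.ker (partitionMap (posRoots n)) where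
  toFun v := ⟨circulation n v, by
    rw [LinearMap.mem_ker, partitionMap_posRoots_eq_iff (by simp), circulation_apply]
    simp⟩
  map_add' v w := Subtype.ext (map_add _ v w)
  map_smul' a v := Subtype.ext (map_smul (circulation n) a v)
  invFun u := innerFlow u.1
  left_inv v := by simp [circulation_apply]
  right_inv u := by
    have := (partitionMap_posRoots_eq_iff (by simp)).1 (LinearMap.mem_ker.1 u.2)
    refine Subtype.ext ?_
    change joinFlow _ _ = _
    conv_rhs => rw [← joinFlow_sinkFlow_innerFlow u.1]
    congr 1
    ext i
    simp [this]

lemma coe_kerEquiv {n : ℕ} (v : Edge n → ℝ) : (kerEquiv n v : Edge (n + 1) → ℝ) =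
    joinFlow (excess v) v := rfl

lemma excess_zero {n : ℕ} : excess (0 : Edge n → ℝ) = 0 := by
  ext i
  simp [excess, inflow, outflow]

/-- The flows supported on the edges into the last vertex. -/
def sinkSection (n : ℕ) : (Fin n → ℝ) →ₗ[ℝ] (Edge (n + 1) → ℝ) where
  toFun c := joinFlow c 0
  map_add' c c' := by rw [← joinFlow_add, add_zero]
  map_smul' a c := by rw [RingHom.id_apply, ← joinFlow_smul, smul_zero]

lemma sinkSection_apply {n : ℕ} (c : Fin n → ℝ) : sinkSection n c = joinFlow c 0 := rfl

/-- The span of the positive roots is parametrized by all but the last coordinate. -/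
def rangeEquiv (n : ℕ) : (Fin n → ℝ) ≃ₗ[ℝ] LinearMap.range (partitionMap (posRoots n)) where
  toFun c := ⟨partitionMap (posRoots n) (sinkSection n c), LinearMap.mem_range_self _ _⟩
  map_add' c c' := Subtype.ext (by simp)
  map_smul' a c := Subtype.ext (by simp)
  invFun a := fun i => a.1 i.castSucc
  left_inv c := by
    ext i
    simp [partitionMap_castSucc, sinkSection_apply, excess_zero]
  right_inv := by
    rintro ⟨_, u, rfl⟩
    refine Subtype.ext ?_
    change partitionMap (posRoots n) (sinkSection n _) = _
    rw [partitionMap_posRoots_eq_iff (sum_partitionMap_posRoots n u)]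
    simp [sinkSection_apply, excess_zero]

lemma coe_rangeEquiv_castSucc {n : ℕ} (c : Fin n → ℝ) (i : Fin n) :
    (rangeEquiv n c : Fin (n + 1) → ℝ) i.castSucc = c i :=
  congrFun ((rangeEquiv n).symm_apply_apply c) i

lemma posRoots_mem_integralVectors (n : ℕ) (e : Edge (n + 1)) :
    posRoots n e ∈ integralVectors (Fin (n + 1)) := fun i => by
  refine ⟨(Pi.single e.1.1 1 - Pi.single e.1.2 1 : Fin (n + 1) → ℤ) i, ?_⟩
  simp only [posRoots, Pi.sub_apply, Pi.single_apply]
  split_ifs <;> simp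

/-- The roots `e^i - e^(n+1)` alone generate the root lattice, so dropping the last coordinate
identifies it with `ℤ^n`. -/
lemma spanMeasure_posRoots (n : ℕ) :
    spanMeasure (posRoots n) = (volume : Measure (Fin n → ℝ)).map (rangeEquiv n) := by
  refine latticeMeasure_eq_map (rangeEquiv n) fun c => ?_
  change (rangeEquiv n c : Fin (n + 1) → ℝ) ∈ Submodule.span ℤ (Set.range (posRoots n)) ↔ _
  constructor
  · intro h i
    have h1 : Submodule.span ℤ (Set.range (posRoots n)) ≤ integralVectors (Fin (n + 1)) :=
      Submodule.span_le.2 (by rintro _ ⟨e, rfl⟩; exact posRoots_mem_integralVectors n e)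
    rw [← coe_rangeEquiv_castSucc c i]
    exact h1 h i.castSucc
  · intro h
    change partitionMap (posRoots n) (sinkSection n c) ∈ _
    rw [partitionMap, Fintype.linearCombination_apply]
    refine Submodule.sum_mem _ fun e _ => ?_
    have he : ∃ k : ℤ, sinkSection n c e = k := by
      obtain ⟨x, rfl⟩ := (edgeCastSuccEquiv n).surjective e
      rcases x with i | e
      · obtain ⟨k, hk⟩ := h i
        exact ⟨k, by rw [← hk]; exact congrFun (sinkFlow_joinFlow c 0) i⟩
      · exact ⟨0, by rw [Int.cast_zero]; exact congrFun (innerFlow_joinFlow c 0) e⟩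
    obtain ⟨k, hk⟩ := he
    rw [hk, Int.cast_smul_eq_zsmul]
    exact Submodule.smul_mem _ _ (Submodule.subset_span ⟨e, rfl⟩)

lemma measurePreserving_shear {X Y : Type*} [MeasurableSpace X] [MeasurableSpace Y] [AddGroup Y]
    [MeasurableAdd₂ Y] {μ : Measure X} {ν : Measure Y} [SFinite μ] [SFinite ν]
    [ν.IsAddRightInvariant] {h : X → Y} (hh : Measurable h) :
    MeasurePreserving (fun p : X × Y => (p.1, p.2 + h p.1)) (μ.prod ν) (μ.prod ν) :=
  (MeasurePreserving.id μ).skew_product (g := fun a c => c + h a)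
    (by fun_prop) (Filter.Eventually.of_forall fun a => map_add_right_eq_self ν (h a))

lemma MeasureTheory.MeasurePreserving.of_linearEquiv {V W : Type*} [NormedAddCommGroup V]
    [NormedSpace ℝ V] [FiniteDimensional ℝ V] [MeasurableSpace V] [BorelSpace V]
    [NormedAddCommGroup W] [NormedSpace ℝ W] [FiniteDimensional ℝ W] [MeasurableSpace W]
    [BorelSpace W] (φ : V ≃ₗ[ℝ] W) (μ : Measure V) :
    MeasurePreserving φ.symm (μ.map φ) μ := by
  have h1 : Measurable φ := φ.toContinuousLinearEquiv.continuous.measurable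
  have h2 : Measurable φ.symm := φ.symm.toContinuousLinearEquiv.continuous.measurable
  refine ⟨h2, ?_⟩
  rw [Measure.map_map h2 h1]
  have : φ.symm ∘ φ = id := by
    ext v
    simp
  rw [this, Measure.map_id]

lemma isAddHaarMeasure_map_kerEquiv (n : ℕ) :
    ((volume : Measure (Edge n → ℝ)).map (kerEquiv n)).IsAddHaarMeasure :=
  (kerEquiv n).toContinuousLinearEquiv.isAddHaarMeasure_map volume

lemma isAddHaarMeasure_map_rangeEquiv (n : ℕ) :
    ((volume : Measure (Fin n → ℝ)).map (rangeEquiv n)).IsAddHaarMeasure :=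
  (rangeEquiv n).toContinuousLinearEquiv.isAddHaarMeasure_map volume

lemma isQuotientMeasure_map_kerEquiv (n : ℕ) :
    IsQuotientMeasure (posRoots n) ((volume : Measure (Edge n → ℝ)).map (kerEquiv n)) := by
  have hK := isAddHaarMeasure_map_kerEquiv n
  have hW := isAddHaarMeasure_map_rangeEquiv n
  refine ⟨hK, fun s hs => ?_⟩
  rw [spanMeasure_posRoots]
  have hequiv := (MeasurePreserving.of_linearEquiv (kerEquiv n) volume).prod
    (MeasurePreserving.of_linearEquiv (rangeEquiv n) volume)
  -- In the coordinates (inner flow, sink flow), `(v, c)` goes to `(v + B c, c + excess (v + B c))`.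
  -- This is a composite of two shears, whatever the section `s`.
  set B : (Fin n → ℝ) → (Edge n → ℝ) := fun c => innerFlow (s (rangeEquiv n c)) with hB
  have hBm : Measurable B := by
    have h1 : Continuous (rangeEquiv n) := (rangeEquiv n).toContinuousLinearEquiv.continuous
    have h2 : Continuous s := s.continuous_of_finiteDimensional
    have h3 : Continuous fun c => s (rangeEquiv n c) := h2.comp h1
    refine Continuous.measurable (continuous_pi fun e => ?_)
    exact (continuous_apply _).comp h3
  have h1 : MeasurePreserving (fun p : (Fin n → ℝ) × (Edge n → ℝ) => (p.1, p.2 + B p.1))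
    (volume.prod volume) (volume.prod volume) := measurePreserving_shear hBm
  have h2 : MeasurePreserving (fun p : (Edge n → ℝ) × (Fin n → ℝ) => (p.1, p.2 + excess p.1))
    (volume.prod volume) (volume.prod volume) :=
    measurePreserving_shear continuous_excess.measurable
  have h3 := (measurePreserving_piSplit (edgeCastSuccEquiv n)).symm
  have hcomp := h3.comp (Measure.measurePreserving_swap.comp
    (h2.comp (Measure.measurePreserving_swap.comp
      (h1.comp (Measure.measurePreserving_swap.comp hequiv)))))
  suffices heq : (fun x : LinearMap.ker (partitionMap (posRoots n)) ×
      LinearMap.range (partitionMap (posRoots n)) => (x.1 : Edge (n + 1) → ℝ) + s x.2) = _ from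
    heq ▸ hcomp
  ext p : 1
  obtain ⟨v, hv⟩ := (kerEquiv n).surjective p.1
  obtain ⟨c, hc⟩ := (rangeEquiv n).surjective p.2
  rw [show p = (kerEquiv n v, rangeEquiv n c) from Prod.ext hv.symm hc.symm]
  simp only [Function.comp_apply, Prod.map_apply, LinearEquiv.symm_apply_apply, Prod.swap_prod_mk]
  rw [MeasurableEquiv.eq_symm_apply, piSplit_apply]
  have hsec := hs (rangeEquiv n c)
  have hz : ∑ k, (rangeEquiv n c : Fin (n + 1) → ℝ) k = 0 := by
    rw [← hsec]
    exact sum_partitionMap_posRoots n _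
  rw [partitionMap_posRoots_eq_iff hz] at hsec
  have hinner : innerFlow (kerEquiv n v : Edge (n + 1) → ℝ) = v := by
    rw [coe_kerEquiv, innerFlow_joinFlow]
  have hsink : sinkFlow (kerEquiv n v : Edge (n + 1) → ℝ) = excess v := by
    rw [coe_kerEquiv, sinkFlow_joinFlow]
  refine Prod.ext ?_ ?_
  · ext i
    change sinkFlow (kerEquiv n v : Edge (n + 1) → ℝ) i + sinkFlow (s (rangeEquiv n c)) i = _
    rw [hsec, hsink, coe_rangeEquiv_castSucc, excess_add]
    simp only [Pi.add_apply, hB]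
    ring
  · ext e
    change innerFlow (kerEquiv n v : Edge (n + 1) → ℝ) e + innerFlow (s (rangeEquiv n c)) e = _
    rw [hinner]
    rfl

/-- `quotientMeasure` is picked by choice, so uniqueness is needed to compute it. One section
determines the product measure, and a slice of measure one recovers the factor `dm`. -/
lemma IsQuotientMeasure.eq_map_kerEquiv {n : ℕ}
    {dm : Measure (LinearMap.ker (partitionMap (posRoots n)))}
    (h : IsQuotientMeasure (posRoots n) dm) :
    dm = (volume : Measure (Edge n → ℝ)).map (kerEquiv n) := by
  have h' := isQuotientMeasure_map_kerEquiv n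
  have hK := h'.1
  have hdm := h.1
  have hW := isAddHaarMeasure_map_rangeEquiv n
  set s : LinearMap.range (partitionMap (posRoots n)) →ₗ[ℝ] (Edge (n + 1) → ℝ) :=
    (sinkSection n).comp (rangeEquiv n).symm.toLinearMap with hsdef
  have hs : ∀ a, partitionMap (posRoots n) (s a) = (a : Fin (n + 1) → ℝ) := fun a =>
    congrArg Subtype.val ((rangeEquiv n).apply_symm_apply a)
  have e1 := h.2 s hs
  have e2 := h'.2 s hs
  rw [spanMeasure_posRoots] at e1 e2
  set inv : (Edge (n + 1) → ℝ) → LinearMap.ker (partitionMap (posRoots n)) ×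
      LinearMap.range (partitionMap (posRoots n)) := fun u =>
    (kerEquiv n (innerFlow u), rangeEquiv n (sinkFlow u - excess (innerFlow u))) with hinv
  have hinvm : Measurable inv := by
    have c1 : Continuous (kerEquiv n) := (kerEquiv n).toContinuousLinearEquiv.continuous
    have c2 : Continuous (rangeEquiv n) := (rangeEquiv n).toContinuousLinearEquiv.continuous
    have c3 : Continuous (innerFlow (n := n)) := continuous_pi fun e => continuous_apply _
    have c4 : Continuous (sinkFlow (n := n)) := continuous_pi fun e => continuous_apply _
    exact ((c1.comp c3).prodMk (c2.comp (c4.sub (continuous_excess.comp c3)))).measurable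
  have hleft : inv ∘ (fun x : LinearMap.ker (partitionMap (posRoots n)) ×
      LinearMap.range (partitionMap (posRoots n)) => (x.1 : Edge (n + 1) → ℝ) + s x.2) = id := by
    ext p : 1
    obtain ⟨v, hv⟩ := (kerEquiv n).surjective p.1
    obtain ⟨c, hc⟩ := (rangeEquiv n).surjective p.2
    rw [show p = (kerEquiv n v, rangeEquiv n c) from Prod.ext hv.symm hc.symm]
    have : (kerEquiv n v : Edge (n + 1) → ℝ) + s (rangeEquiv n c) =
        joinFlow (excess v + c) v := by
      rw [coe_kerEquiv, hsdef, LinearMap.comp_apply, LinearEquiv.coe_coe,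
        LinearEquiv.symm_apply_apply, sinkSection_apply, ← joinFlow_add, add_zero]
    simp only [Function.comp_apply, this, hinv, innerFlow_joinFlow, sinkFlow_joinFlow,
      add_sub_cancel_left, id]
  have hprod : dm.prod ((volume : Measure (Fin n → ℝ)).map (rangeEquiv n)) =
      ((volume : Measure (Edge n → ℝ)).map (kerEquiv n)).prod
        ((volume : Measure (Fin n → ℝ)).map (rangeEquiv n)) := by
    have m1 := Measure.map_map (μ := dm.prod ((volume : Measure (Fin n → ℝ)).map (rangeEquiv n)))
      hinvm e1.measurable
    have m2 := Measure.map_map (μ := ((volume : Measure (Edge n → ℝ)).map (kerEquiv n)).prod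
      ((volume : Measure (Fin n → ℝ)).map (rangeEquiv n))) hinvm e2.measurable
    rw [hleft, Measure.map_id] at m1 m2
    rw [← m1, ← m2, e1.map_eq, e2.map_eq]
  ext T hT
  set D : Set (LinearMap.range (partitionMap (posRoots n))) :=
    (rangeEquiv n).symm ⁻¹' (Set.pi Set.univ fun _ => Set.Icc (0 : ℝ) 1)
  have hD : (volume : Measure (Fin n → ℝ)).map (rangeEquiv n) D = 1 := by
    have := (rangeEquiv n).toContinuousLinearEquiv.toHomeomorph.toMeasurableEquiv.map_apply
      (μ := volume) D
    refine this.trans ?_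
    have hpre : (rangeEquiv n) ⁻¹' D = Set.pi Set.univ fun _ => Set.Icc (0 : ℝ) 1 := by
      ext c
      simp [D]
    refine (congrArg volume hpre).trans ?_
    rw [volume_pi_pi]
    simp
  have := congrArg (fun μ => μ (T ×ˢ D)) hprod
  simpa only [Measure.prod_prod, hD, mul_one] using this

lemma quotientMeasure_posRoots (n : ℕ) :
    quotientMeasure (posRoots n) = (volume : Measure (Edge n → ℝ)).map (kerEquiv n) := by
  have h : ∃ dm, IsQuotientMeasure (posRoots n) dm := ⟨_, isQuotientMeasure_map_kerEquiv n⟩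
  rw [quotientMeasure, dif_pos h]
  exact h.choose_spec.eq_map_kerEquiv

/-- The flow polytope is parametrized by the flows away from the last vertex. -/
lemma partitionPolytope_posRoots (m : ℕ) :
    partitionPolytope (posRoots (m + 1)) (Pi.single 0 1 - Pi.single (Fin.last (m + 1)) 1) =
      (fun v => joinFlow (Pi.single 0 1) 0 + (kerEquiv (m + 1) v : Edge (m + 2) → ℝ)) ''
        flowSet (Pi.single 0 1) := by
  have hz : ∑ k, (Pi.single 0 1 - Pi.single (Fin.last (m + 1)) 1 : Fin (m + 2) → ℝ) k = 0 := by
    simp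
  have ha : ∀ i : Fin (m + 1),
      (Pi.single 0 1 - Pi.single (Fin.last (m + 1)) 1 : Fin (m + 2) → ℝ) i.castSucc =
        (Pi.single 0 1 : Fin (m + 1) → ℝ) i := fun i => by
    have h1 : i.castSucc ≠ Fin.last (m + 1) := (Fin.castSucc_lt_last i).ne
    simp [Pi.single_apply, h1]
  have hpos : ∀ u : Edge (m + 2) → ℝ, (∀ e, 0 ≤ u e) ↔
      (∀ i, 0 ≤ sinkFlow u i) ∧ ∀ e, 0 ≤ innerFlow u e := fun u => by
    rw [← (edgeCastSuccEquiv (m + 1)).forall_congr_right, Sum.forall]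
    rfl
  have hmem : ∀ u : Edge (m + 2) → ℝ, u ∈ partitionPolytope (posRoots (m + 1))
      (Pi.single 0 1 - Pi.single (Fin.last (m + 1)) 1) ↔ (∀ e, 0 ≤ u e) ∧
      ∀ i : Fin (m + 1), sinkFlow u i =
        (Pi.single 0 1 : Fin (m + 1) → ℝ) i + excess (innerFlow u) i := fun u => by
    simp only [← ha]
    rw [← partitionMap_posRoots_eq_iff hz]
    rfl
  have hjoin : ∀ v : Edge (m + 1) → ℝ,
      joinFlow (Pi.single 0 1) 0 + (kerEquiv (m + 1) v : Edge (m + 2) → ℝ) =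
        joinFlow (Pi.single 0 1 + excess v) v := fun v => by
    rw [coe_kerEquiv, ← joinFlow_add, zero_add]
  simp only [hjoin]
  ext u
  rw [hmem, hpos]
  constructor
  · rintro ⟨⟨h1, h2⟩, h3⟩
    refine ⟨innerFlow u, ⟨h2, fun i => ?_⟩, ?_⟩
    · have := h1 i
      rw [h3, excess] at this
      linarith
    · exact (congrArg (fun c => joinFlow c (innerFlow u)) (funext fun i => (h3 i).symm)).trans
        (joinFlow_sinkFlow_innerFlow u)
  · rintro ⟨v, hv, rfl⟩
    simp only [sinkFlow_joinFlow, innerFlow_joinFlow, Pi.add_apply]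
    refine ⟨⟨fun i => ?_, hv.1⟩, fun i => trivial⟩
    have := hv.2 i
    rw [excess]
    linarith

/-- Positive volume follows from the formula, Catalan numbers being nonzero. It guarantees a
full-dimensional parameter set, so the affine span of the polytope is the whole image. -/
lemma volume_flowSet_ne_zero (m : ℕ) :
    volume (flowSet (Pi.single 0 1 : Fin (m + 1) → ℝ)) ≠ 0 := fun h => by
  have := factorial_mul_volume_flowSet m
  rw [measureReal_def, h, ENNReal.toReal_zero, mul_zero, eq_comm, Finset.prod_eq_zero_iff] at this
  obtain ⟨i, -, hi⟩ := this
  have h1 := succ_mul_catalan_eq_centralBinom i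
  rw [Nat.cast_eq_zero.1 hi, mul_zero] at h1
  exact (Nat.centralBinom_pos i).ne h1

theorem partitionRelVolume_posRoots (m : ℕ) :
    partitionRelVolume (posRoots (m + 1)) (Pi.single 0 1 - Pi.single (Fin.last (m + 1)) 1) =
      ∏ i ∈ Finset.range m, (catalan i : ℝ) := by
  rw [partitionRelVolume, partitionVolume, quotientMeasure_posRoots, partitionPolytope_posRoots,
    map_real_translateTo _ _ (nonempty_of_measure_ne_zero (volume_flowSet_ne_zero m)),
    ← (kerEquiv (m + 1)).finrank_eq, Module.finrank_fintype_fun_eq_card,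
    factorial_mul_volume_flowSet]

/-! ### The Chan–Robbins–Yuen polytope as a flow polytope. -/

/-- The flow from `a` to `b`, extended by zero to all pairs of vertices. -/
def flowEntry {n : ℕ} (u : Edge n → ℝ) (a b : Fin n) : ℝ :=
  if h : a < b then u ⟨(a, b), h⟩ else 0

lemma sum_edge_eq_sum {n : ℕ} (F : Fin n → Fin n → ℝ) :
    ∑ e : Edge n, F e.1.1 e.1.2 = ∑ a, ∑ b, if a < b then F a b else 0 := by
  rw [← Fintype.sum_prod_type' (f := fun a b => if a < b then F a b else 0),
    ← Finset.sum_filter,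
    ← Finset.sum_subtype (Finset.univ.filter fun p : Fin n × Fin n => p.1 < p.2) (by simp)
      (fun p => F p.1 p.2)]

lemma flowEntry_coe {n : ℕ} (u : Edge n → ℝ) (e : Edge n) : flowEntry u e.1.1 e.1.2 = u e :=
  dif_pos e.2

lemma inflow_eq_sum {n : ℕ} (u : Edge n → ℝ) (k : Fin n) : inflow u k = ∑ a, flowEntry u a k := by
  have h := sum_edge_eq_sum fun a b => if b = k then flowEntry u a b else 0
  simp only [flowEntry_coe] at h
  rw [inflow, h]
  refine Finset.sum_congr rfl fun a _ => ?_
  rw [Finset.sum_eq_single k]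
  · simp only [if_true]
    split_ifs with hak
    · rfl
    · rw [flowEntry, dif_neg hak]
  · intro b _ hb
    simp [hb]
  · simp

lemma outflow_eq_sum {n : ℕ} (u : Edge n → ℝ) (k : Fin n) :
    outflow u k = ∑ b, flowEntry u k b := by
  have h := sum_edge_eq_sum fun a b => if a = k then flowEntry u a b else 0
  simp only [flowEntry_coe] at h
  rw [outflow, h, Finset.sum_eq_single k]
  · refine Finset.sum_congr rfl fun b _ => ?_
    simp only [if_true]
    split_ifs with hak
    · rfl
    · rw [flowEntry, dif_neg hak]
  · intro a _ ha
    simp [ha]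
  · simp

lemma inflow_succ_eq_sum {n : ℕ} (u : Edge (n + 1) → ℝ) (i : Fin n) :
    inflow u i.succ = ∑ j : Fin n, flowEntry u j.castSucc i.succ := by
  rw [inflow_eq_sum, Fin.sum_univ_castSucc, add_eq_left, flowEntry, dif_neg]
  exact not_lt.2 (Fin.le_last _)

lemma outflow_castSucc_eq_sum {n : ℕ} (u : Edge (n + 1) → ℝ) (j : Fin n) :
    outflow u j.castSucc = ∑ i : Fin n, flowEntry u j.castSucc i.succ := by
  rw [outflow_eq_sum, Fin.sum_univ_succ, add_eq_right, flowEntry, dif_neg]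
  exact not_lt.2 (Fin.zero_le _)

lemma flowEntry_add {n : ℕ} (u v : Edge n → ℝ) (a b : Fin n) :
    flowEntry (u + v) a b = flowEntry u a b + flowEntry v a b := by
  simp only [flowEntry]
  split_ifs <;> simp

lemma flowEntry_smul {n : ℕ} (c : ℝ) (u : Edge n → ℝ) (a b : Fin n) :
    flowEntry (c • u) a b = c * flowEntry u a b := by
  simp only [flowEntry]
  split_ifs <;> simp

lemma flowEntry_nonneg {n : ℕ} {u : Edge n → ℝ} (hu : ∀ e, 0 ≤ u e) (a b : Fin n) :
    0 ≤ flowEntry u a b := by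
  simp only [flowEntry]
  split_ifs
  · exact hu _
  · exact le_rfl

lemma inflow_add {n : ℕ} (u v : Edge n → ℝ) (i : Fin n) :
    inflow (u + v) i = inflow u i + inflow v i := by
  simp only [inflow_eq_sum, flowEntry_add, Finset.sum_add_distrib]

/-- The linear part of the map from flows to lower Hessenberg matrices: the flow from `j` to
`i + 1` is the entry at `(i, j)`, and the superdiagonal makes the row sums equal. -/
def hessenbergLinear (n : ℕ) : (Edge (n + 1) → ℝ) →ₗ[ℝ] (Fin n × Fin n → ℝ) where
  toFun u p := flowEntry u p.2.castSucc p.1.succ -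
    if (p.2 : ℕ) = p.1 + 1 then inflow u p.1.succ else 0
  map_add' u v := by
    ext p
    simp only [flowEntry_add, inflow_add, Pi.add_apply]
    split_ifs <;> ring
  map_smul' c u := by
    ext p
    simp only [flowEntry_smul, inflow_smul, Pi.smul_apply, smul_eq_mul, RingHom.id_apply]
    split_ifs <;> ring

/-- The matrix with ones on the superdiagonal. -/
def superdiagonal (n : ℕ) (p : Fin n × Fin n) : ℝ := if (p.2 : ℕ) = p.1 + 1 then 1 else 0

lemma hessenbergLinear_apply {n : ℕ} (u : Edge (n + 1) → ℝ) (p : Fin n × Fin n) :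
    hessenbergLinear n u p = flowEntry u p.2.castSucc p.1.succ -
      if (p.2 : ℕ) = p.1 + 1 then inflow u p.1.succ else 0 := rfl

lemma hessenberg_apply {n : ℕ} (u : Edge (n + 1) → ℝ) (i j : Fin n) :
    (superdiagonal n + hessenbergLinear n u) (i, j) = flowEntry u j.castSucc i.succ +
      if (j : ℕ) = i + 1 then 1 - inflow u i.succ else 0 := by
  rw [Pi.add_apply, superdiagonal, hessenbergLinear_apply]
  dsimp only
  split_ifs <;> ring

lemma exists_edge_eq {n : ℕ} (e : Edge (n + 1)) :
    ∃ i j : Fin n, ∃ h : j.castSucc < i.succ, e = ⟨(j.castSucc, i.succ), h⟩ := by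
  obtain ⟨⟨a, b⟩, h⟩ := e
  obtain ⟨j, rfl⟩ := Fin.exists_castSucc_eq.2 (Fin.ne_last_of_lt h)
  obtain ⟨i, rfl⟩ := Fin.exists_succ_eq.2 (Fin.ne_zero_of_lt h)
  exact ⟨i, j, h, rfl⟩

/-- Edges correspond to entries on or below the diagonal, where the superdiagonal correction
vanishes. Flow values are thus read off unchanged, which gives injectivity and integrality. -/
lemma hessenbergLinear_edge {n : ℕ} (u : Edge (n + 1) → ℝ) {i j : Fin n}
    (h : j.castSucc < i.succ) :
    hessenbergLinear n u (i, j) = u ⟨(j.castSucc, i.succ), h⟩ := by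
  have hne : ¬ (j : ℕ) = i + 1 := by
    rw [Fin.lt_def] at h
    simp only [Fin.val_castSucc, Fin.val_succ] at h
    omega
  rw [hessenbergLinear_apply]
  dsimp only
  rw [if_neg hne, sub_zero, flowEntry, dif_pos h]

lemma hessenbergLinear_injective (n : ℕ) : Function.Injective (hessenbergLinear n) := by
  intro u v huv
  ext e
  obtain ⟨i, j, h, rfl⟩ := exists_edge_eq e
  rw [← hessenbergLinear_edge u h, ← hessenbergLinear_edge v h, huv]

lemma inflow_integral {n : ℕ} {u : Edge n → ℝ} (hu : u ∈ integralVectors (Edge n)) (k : Fin n) :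
    ∃ a : ℤ, inflow u k = a := by
  choose a ha using hu
  refine ⟨∑ e : Edge n, if e.1.2 = k then a e else 0, ?_⟩
  push_cast
  simp only [inflow, ha]

lemma outflow_integral {n : ℕ} {u : Edge n → ℝ} (hu : u ∈ integralVectors (Edge n)) (k : Fin n) :
    ∃ a : ℤ, outflow u k = a := by
  choose a ha using hu
  refine ⟨∑ e : Edge n, if e.1.1 = k then a e else 0, ?_⟩
  push_cast
  simp only [outflow, ha]

lemma hessenbergLinear_mem_integralVectors {n : ℕ} (u : Edge (n + 1) → ℝ) :
    hessenbergLinear n u ∈ integralVectors (Fin n × Fin n) ↔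
      u ∈ integralVectors (Edge (n + 1)) := by
  constructor
  · intro hu e
    obtain ⟨i, j, h, rfl⟩ := exists_edge_eq e
    rw [← hessenbergLinear_edge u h]
    exact hu (i, j)
  · rintro hu ⟨i, j⟩
    obtain ⟨a, ha⟩ := inflow_integral hu i.succ
    rw [hessenbergLinear_apply, ha, flowEntry]
    dsimp only
    by_cases h : j.castSucc < i.succ
    · obtain ⟨b, hb⟩ := hu ⟨(j.castSucc, i.succ), h⟩
      refine ⟨b - if (j : ℕ) = i + 1 then a else 0, ?_⟩
      rw [dif_pos h, hb]
      push_cast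
      rfl
    · refine ⟨-if (j : ℕ) = i + 1 then a else 0, ?_⟩
      rw [dif_neg h]
      push_cast
      ring

lemma circulation_mem_integralVectors {n : ℕ} (v : Edge n → ℝ) :
    circulation n v ∈ integralVectors (Edge (n + 1)) ↔ v ∈ integralVectors (Edge n) := by
  rw [circulation_apply]
  constructor
  · intro hv e
    rw [← innerFlow_joinFlow (excess v) v]
    exact hv _
  · intro hv e
    obtain ⟨x, rfl⟩ := (edgeCastSuccEquiv n).surjective e
    rcases x with i | e
    · obtain ⟨a, ha⟩ := inflow_integral hv i
      obtain ⟨b, hb⟩ := outflow_integral hv i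
      refine ⟨a - b, ?_⟩
      rw [Int.cast_sub, ← ha, ← hb]
      exact congrFun (sinkFlow_joinFlow (excess v) v) i
    · obtain ⟨a, ha⟩ := hv e
      exact ⟨a, (congrFun (innerFlow_joinFlow (excess v) v) e).trans ha⟩

/-- In a unit flow from the first to the last vertex, at most one unit enters each vertex. -/
lemma inflow_le_one {m : ℕ} {u : Edge (m + 2) → ℝ} (hu : ∀ e, 0 ≤ u e)
    (h : ∀ k, outflow u k - inflow u k =
      (Pi.single 0 1 - Pi.single (Fin.last (m + 1)) 1 : Fin (m + 2) → ℝ) k) (k : Fin (m + 2)) :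
    inflow u k ≤ 1 := by
  -- A cut argument: the vertices before `k` emit at most one unit net, only vertex `0` being a
  -- source.
  have h1 : ∑ l, (if l < k then outflow u l - inflow u l else 0) ≤ 1 := by
    have : ∀ l, (if l < k then outflow u l - inflow u l else 0) ≤
        (Pi.single 0 1 : Fin (m + 2) → ℝ) l := fun l => by
      split_ifs with hl
      · rw [h, Pi.sub_apply, Pi.single_apply (Fin.last (m + 1)), if_neg (Fin.ne_last_of_lt hl),
          sub_zero]
      · rw [Pi.single_apply]
        split_ifs <;> norm_num
    refine (Finset.sum_le_sum fun l _ => this l).trans ?_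
    simp
  refine le_trans ?_ h1
  -- Counted by edges, the net emission is the flow crossing the cut, which includes every edge into
  -- `k`.
  have h2 : ∑ l, (if l < k then outflow u l - inflow u l else 0) =
      ∑ e : Edge (m + 2), ((if e.1.1 < k then u e else 0) - if e.1.2 < k then u e else 0) := by
    have : ∀ l, (if l < k then outflow u l - inflow u l else 0) = ∑ e : Edge (m + 2),
        ((if e.1.1 = l then (if l < k then u e else 0) else 0) -
          if e.1.2 = l then (if l < k then u e else 0) else 0) := fun l => by
      rw [Finset.sum_sub_distrib]
      split_ifs
      · rfl
      · simp
    simp only [this]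
    rw [Finset.sum_comm]
    simp [Finset.sum_sub_distrib]
  rw [h2]
  refine Finset.sum_le_sum fun e _ => ?_
  have h3 := e.2
  have h4 := hu e
  split_ifs with a b c d f <;> try linarith
  · exact absurd a c.ne
  · exact absurd (a ▸ h3) b
  · exact absurd (a ▸ h3) b
  · exact absurd (h3.trans ‹_›) ‹_›

/-- The superdiagonal slack completes each row to `1`. The last row has no such slot and records the
inflow at the sink. -/
lemma sum_hessenberg_row {m : ℕ} (u : Edge (m + 2) → ℝ) (i : Fin (m + 1)) :
    ∑ j, (superdiagonal (m + 1) + hessenbergLinear (m + 1) u) (i, j) =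
      if i = Fin.last m then inflow u (Fin.last (m + 1)) else 1 := by
  simp only [hessenberg_apply, Finset.sum_add_distrib]
  rw [← inflow_succ_eq_sum]
  rcases Fin.eq_castSucc_or_eq_last i with ⟨i, rfl⟩ | rfl
  · rw [if_neg (Fin.castSucc_lt_last i).ne, Finset.sum_eq_single i.succ]
    · simp
    · intro j _ hj
      refine if_neg fun h => hj (Fin.ext ?_)
      simpa using h
    · simp
  · rw [if_pos rfl, Fin.succ_last, add_eq_left]
    refine Finset.sum_eq_zero fun j _ => if_neg ?_
    have := j.2
    simp only [Fin.val_last]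
    omega

/-- Column `j` holds the flow out of `j` and the slack `1 - inflow` at `j`, so its sum is `1`
exactly when flow is conserved there. Column `0` has no slack and expresses the unit supply. -/
lemma sum_hessenberg_column {m : ℕ} (u : Edge (m + 2) → ℝ) (j : Fin (m + 1)) :
    ∑ i, (superdiagonal (m + 1) + hessenbergLinear (m + 1) u) (i, j) =
      outflow u j.castSucc + if j = 0 then 0 else 1 - inflow u j.castSucc := by
  simp only [hessenberg_apply, Finset.sum_add_distrib]
  rw [← outflow_castSucc_eq_sum]
  congr 1
  rcases Fin.eq_zero_or_eq_succ j with rfl | ⟨j, rfl⟩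
  · simp
  · rw [if_neg (Fin.succ_ne_zero j), Finset.sum_eq_single j.castSucc]
    · rw [if_pos (by simp), Fin.succ_castSucc]
    · intro i _ hi
      refine if_neg fun h => hi (Fin.ext ?_)
      simp only [Fin.val_succ] at h
      simp only [Fin.val_castSucc]
      omega
    · simp

lemma mem_CRY_iff {n : ℕ} (X : Fin n × Fin n → ℝ) :
    X ∈ CRY n ↔ ((∀ i j, 0 ≤ X (i, j)) ∧ (∀ i, ∑ j, X (i, j) = 1) ∧ ∀ j, ∑ i, X (i, j) = 1) ∧
      ∀ i j : Fin n, (i : ℕ) + 2 ≤ (j : ℕ) → X (i, j) = 0 := by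
  rw [CRY, Set.mem_ofPred_eq, mem_doublyStochastic_iff_sum]
  rfl

/-- Every matrix in the polytope comes from a flow. -/
lemma exists_hessenberg_eq {m : ℕ} {X : Fin (m + 1) × Fin (m + 1) → ℝ} (hX : X ∈ CRY (m + 1)) :
    ∃ u : Edge (m + 2) → ℝ, (∀ e, 0 ≤ u e) ∧
      superdiagonal (m + 1) + hessenbergLinear (m + 1) u = X := by
  rw [mem_CRY_iff] at hX
  obtain ⟨⟨hpos, hrow, -⟩, hzero⟩ := hX
  set u : Edge (m + 2) → ℝ := fun e =>
    X (e.1.2.pred (Fin.ne_zero_of_lt e.2), e.1.1.castPred (Fin.ne_last_of_lt e.2)) with hu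
  have hentry : ∀ i j : Fin (m + 1), flowEntry u j.castSucc i.succ =
      if j ≤ i then X (i, j) else 0 := fun i j => by
    have : j.castSucc < i.succ ↔ j ≤ i := Fin.castSucc_lt_succ_iff
    simp only [flowEntry, this, hu, Fin.pred_succ, Fin.castPred_castSucc]
    split_ifs <;> rfl
  refine ⟨u, fun e => hpos _ _, ?_⟩
  ext ⟨i, j⟩
  rw [hessenberg_apply, hentry]
  rcases lt_trichotomy (j : ℕ) (i + 1) with h | h | h
  · rw [if_pos (Fin.le_def.2 (by omega)), if_neg h.ne, add_zero]
  · rw [if_neg (fun h' => by rw [Fin.le_def] at h'; omega), if_pos h, zero_add, inflow_succ_eq_sum]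
    -- A row has nothing beyond its superdiagonal entry, so the row sum forces that entry to be `1`
    -- minus the entries on or below the diagonal.
    have h1 : ∑ k, X (i, k) = ∑ k, (flowEntry u k.castSucc i.succ +
        if k = j then X (i, k) else 0) := by
      refine Finset.sum_congr rfl fun k _ => ?_
      rw [hentry]
      by_cases hk : k ≤ i
      · rw [if_pos hk, if_neg, add_zero]
        rintro rfl
        rw [Fin.le_def] at hk
        omega
      · rw [if_neg hk, zero_add]
        by_cases hkj : k = j
        · rw [if_pos hkj]
        · rw [if_neg hkj]
          refine hzero i k ?_
          rw [Fin.le_def] at hk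
          have : (k : ℕ) ≠ j := fun h' => hkj (Fin.ext h')
          omega
    rw [hrow, Finset.sum_add_distrib, Finset.sum_ite_eq' Finset.univ j, if_pos (Finset.mem_univ j)]
      at h1
    linarith
  · rw [if_neg (fun h' => by rw [Fin.le_def] at h'; omega), if_neg h.ne', add_zero]
    exact (hzero i j (by omega)).symm

/-- The Chan–Robbins–Yuen polytope is the image of the flow polytope. -/
lemma CRY_eq_image (m : ℕ) :
    CRY (m + 1) = (fun u => superdiagonal (m + 1) + hessenbergLinear (m + 1) u) ''
      partitionPolytope (posRoots (m + 1)) (Pi.single 0 1 - Pi.single (Fin.last (m + 1)) 1) := by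
  have hmem : ∀ u : Edge (m + 2) → ℝ, u ∈ partitionPolytope (posRoots (m + 1))
      (Pi.single 0 1 - Pi.single (Fin.last (m + 1)) 1) ↔ (∀ e, 0 ≤ u e) ∧
      ∀ k, outflow u k - inflow u k =
        (Pi.single 0 1 - Pi.single (Fin.last (m + 1)) 1 : Fin (m + 2) → ℝ) k := fun u => by
    simp only [← partitionMap_posRoots]
    rw [← funext_iff]
    rfl
  have hlast : (Pi.single 0 1 - Pi.single (Fin.last (m + 1)) 1 : Fin (m + 2) → ℝ)
      (Fin.last (m + 1)) = -1 := by
    simp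
  have hcast : ∀ j : Fin (m + 1), (Pi.single 0 1 - Pi.single (Fin.last (m + 1)) 1 :
      Fin (m + 2) → ℝ) j.castSucc = if j = 0 then 1 else 0 := fun j => by
    have h1 : j.castSucc ≠ Fin.last (m + 1) := (Fin.castSucc_lt_last j).ne
    simp [Pi.single_apply, h1]
  ext X
  constructor
  · intro hX
    obtain ⟨u, hu, rfl⟩ := exists_hessenberg_eq hX
    rw [mem_CRY_iff] at hX
    obtain ⟨⟨-, hrow, hcol⟩, -⟩ := hX
    refine ⟨u, (hmem u).2 ⟨hu, fun k => ?_⟩, rfl⟩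
    rcases Fin.eq_castSucc_or_eq_last k with ⟨j, rfl⟩ | rfl
    · have h := hcol j
      rw [sum_hessenberg_column] at h
      rw [hcast]
      split_ifs at h ⊢ with hj
      · subst hj
        rw [Fin.castSucc_zero] at h ⊢
        rw [inflow_zero]
        linarith
      · linarith
    · have h := hrow (Fin.last m)
      rw [sum_hessenberg_row, if_pos rfl] at h
      rw [hlast, outflow_last, h]
      norm_num
  · rintro ⟨u, hu, rfl⟩
    rw [hmem] at hu
    obtain ⟨hu, hnet⟩ := hu
    rw [mem_CRY_iff]
    dsimp only
    refine ⟨⟨fun i j => ?_, fun i => ?_, fun j => ?_⟩, fun i j hij => ?_⟩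
    · rw [hessenberg_apply]
      refine add_nonneg (flowEntry_nonneg hu _ _) ?_
      split_ifs
      · exact sub_nonneg.2 (inflow_le_one hu hnet _)
      · exact le_rfl
    · rw [sum_hessenberg_row]
      split_ifs
      · have h := hnet (Fin.last (m + 1))
        rw [hlast, outflow_last] at h
        linarith
      · rfl
    · rw [sum_hessenberg_column]
      have h := hnet j.castSucc
      rw [hcast] at h
      split_ifs at h ⊢ with hj
      · subst hj
        rw [Fin.castSucc_zero] at h ⊢
        rw [inflow_zero] at h
        linarith
      · linarith
    · rw [hessenberg_apply, if_neg (by omega), add_zero, flowEntry, dif_neg]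
      rw [Fin.castSucc_lt_succ_iff, Fin.le_def]
      omega

theorem latticeRelVolume_CRY (m : ℕ) :
    latticeRelVolume (CRY (m + 1)) = ∏ i ∈ Finset.range m, (catalan i : ℝ) := by
  rw [CRY_eq_image, partitionPolytope_posRoots, Set.image_image]
  have : ∀ v : Edge (m + 1) → ℝ, superdiagonal (m + 1) + hessenbergLinear (m + 1)
      (joinFlow (Pi.single 0 1) 0 + (kerEquiv (m + 1) v : Edge (m + 2) → ℝ)) =
      (superdiagonal (m + 1) + hessenbergLinear (m + 1) (joinFlow (Pi.single 0 1) 0)) +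
        (hessenbergLinear (m + 1) ∘ₗ circulation (m + 1)) v := fun v => by
    rw [map_add]
    exact (add_assoc _ _ _).symm
  simp only [this]
  rw [latticeRelVolume_image _ _ _ _ (volume_flowSet_ne_zero m), factorial_mul_volume_flowSet]
  · intro v
    rw [LinearMap.comp_apply, hessenbergLinear_mem_integralVectors,
      circulation_mem_integralVectors]
  · refine (hessenbergLinear_injective _).comp ?_
    exact Subtype.val_injective.comp (kerEquiv (m + 1)).injective

/-- The factor `catalan 0 = 1` drops out. With `m = n - 1` the upper index `m - 1` is `n - 2`, and
truncated subtraction gives the empty product for `m = 0`. -/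
lemma prod_range_catalan (m : ℕ) :
    ∏ i ∈ Finset.range m, (catalan i : ℝ) =
      ∏ i ∈ Finset.Icc 1 (m - 1), (1 / ((i : ℝ) + 1)) * ((2 * i).choose i : ℝ) := by
  have h : ∀ i : ℕ, (catalan i : ℝ) = (1 / ((i : ℝ) + 1)) * ((2 * i).choose i : ℝ) := fun i => by
    have := congrArg (Nat.cast (R := ℝ)) (succ_mul_catalan_eq_centralBinom i)
    rw [Nat.centralBinom] at this
    rw [← this]
    push_cast
    field_simp
  simp only [← h]
  rcases m with _ | m
  · simp
  · rw [Finset.prod_range_succ', catalan_zero, Nat.cast_one, mul_one, Nat.add_sub_cancel,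
      Finset.range_eq_Ico, Finset.prod_Ico_add' (fun i => (catalan i : ℝ)) 0 m 1]
    rfl

end

theorem mainTheorem2 (n : ℕ) (hn : 1 ≤ n) :
    latticeRelVolume (CRY n) =
        ∏ i ∈ Finset.Icc 1 (n - 2), (1 / ((i : ℝ) + 1)) * ((2 * i).choose i : ℝ) ∧
    partitionRelVolume (posRoots n) (Pi.single 0 1 - Pi.single (Fin.last n) 1) =
        ∏ i ∈ Finset.Icc 1 (n - 2), (1 / ((i : ℝ) + 1)) * ((2 * i).choose i : ℝ) := by
  obtain ⟨m, rfl⟩ : ∃ m, n = m + 1 := ⟨n - 1, by omega⟩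
  have h := prod_range_catalan m
  exact ⟨(latticeRelVolume_CRY m).trans h, (partitionRelVolume_posRoots m).trans h⟩
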